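/- Let $p$ be an odd prime, let $F\subset\overline{\mathbb Q}\subset\mathbb C$ be a totally real abelian number field of conductor $f=p^a d$ with $p\nmid d$, and let $r>1$ be an odd integer. Put $\zeta_n=e^{2\pi i/n}$, $F_n=F(\zeta_{p^n})$ and $\mathbb Q(\zeta_{bp^\infty})=\bigcup_n\mathbb Q(\zeta_{bp^n})$. Let $\Omega_S$ be the maximal algebraic extension of $F$ unramified at all finite primes not dividing $p$, $\mathcal G_S=\mathrm{Gal}(\Omega_S/\mathbb Q)$, $G_S=\mathrm{Gal}(\Omega_S/F)$, $G_S(F_n)=\mathrm{Gal}(\Omega_S/F_n)$, and let $\kappa:\mathcal G_S\to\mathbb Z_p^\times$ be the cyclotomic character. Let $\mathbb Z/p^m(r)$ be $\mathbb Z/p^m$ with $\mathcal G_S$ acting through $\kappa^r$, generated by the tensor power $t(r)_m=\zeta_{p^m}^{\otimes r}$, and let $H^1(G_S,\mathbb Z_p(r))=\varprojlim_m H^1(G_S,\mathbb Z/p^m(r))$ (continuous cohomology), with its natural action of $\mathrm{Gal}(F/\mathbb Q)=\mathcal G_S/G_S$. For an integer $b\ge 1$ dividing $d$, put $$\varepsilon^F_{b,n}=N_{\mathbb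 Q(\zeta_{bp^n})/F_n\cap\mathbb Q(\zeta_{bp^n})}(1-\zeta_{bp^n})\quad (n\ge a'),\qquad \varepsilon^F_{b,n}=N_{F_{a'}/F_n}(\varepsilon^F_{b,a'})\quad (n<a'),\qquad a'=\max(a,1);$$ these are $p$-units of $F_n$. The special element $c^F_b(r)\in H^1(G_S,\mathbb Z_p(r))$ is the element whose component in $H^1(G_S,\mathbb Z/p^m(r))$, for each $m$, is the corestriction from $F_m$ to $F$ of the class in $H^1(G_S(F_m),\mathbb Z/p^m(r))$ of the Kummer cocycle $$g\longmapsto \frac{g\big(\sqrt[p^m]{\varepsilon^F_{b,m}}\big)}{\sqrt[p^m]{\varepsilon^F_{b,m}}}\otimes t(r-1)_m\in\mu_{p^m}(r-1)=\mathbb Z/p^m(r).$$ **Proposition.** Let $\ell$ be a prime and $b\ge 1$ an integer with $\ell b\mid d$. Then the families of classes just described are compatible, so that $c^F_{\ell b}(r)$ and $c^F_b(r)$ are elements of $H^1(G_S,\mathbb Z_p(r))$; they are fixed by $\mathrm{Gal}(F/\mathbb Q(\zeta_{\ell bp^\infty})\cap F)$ and by $\mathrm{Gal}(F/\mathbb Q(\zeta_{bp^\infty})\cap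 F)$ respectively; and $$N_{\mathbb Q(\zeta_{\ell bp^\infty})\cap F\,/\,\mathbb Q(\zeta_{bp^\infty})\cap F}\big(c^F_{\ell b}(r)\big)=\begin{cases}(1-\ell^{\,r-1}\mathrm{Fr}_\ell^{-1})\,c^F_b(r)&\text{if }\ell\nmid b,\\ c^F_b(r)&\text{if }\ell\mid b.\end{cases}$$ Here, for fields $K\subseteq L\subseteq F$ and $x$ fixed by $\mathrm{Gal}(F/L)$, $N_{L/K}(x)=\sum_{g\in\mathrm{Gal}(L/K)}\tilde g\,x$, where $\tilde g\in\mathrm{Gal}(F/K)$ is any lift of $g$; and, for $\ell\nmid b$, $\mathrm{Fr}_\ell\in\mathrm{Gal}(\mathbb Q(\zeta_{bp^\infty})\cap F/\mathbb Q)$ is the restriction of the automorphism of $\mathbb Q(\zeta_{bp^\infty})$ which raises every $\zeta_{bp^n}$ to the power $\ell$. -/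

import Mathlib

/-! ### Continuous first cohomology of subgroups of a topological group -/

namespace ContH1

section

variable {Γ : Type*} [Group Γ] [TopologicalSpace Γ] {A : Type*} [CommRing A]

/-- Continuous `1`-cocycles of the subgroup `H` with values in the discrete module `A` on which
`Γ` acts through the character `χ`, that is, `g • x = χ g * x`. -/
def Z1 (χ : Γ →* Aˣ) (H : Subgroup Γ) : AddSubgroup (H → A) where
  carrier := {f | IsLocallyConstant f ∧ ∀ g h : H, f (g * h) = f g + (χ g : A) * f h}
  zero_mem' := ⟨IsLocallyConstant.const 0, by simp⟩
  add_mem' := by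
    rintro f₁ f₂ ⟨h₁, h₁'⟩ ⟨h₂, h₂'⟩
    refine ⟨h₁.add h₂, fun g h => ?_⟩
    simp only [Pi.add_apply, h₁', h₂']
    ring
  neg_mem' := by
    rintro f ⟨h₁, h₁'⟩
    refine ⟨h₁.neg, fun g h => ?_⟩
    simp only [Pi.neg_apply, h₁']
    ring

/-- `1`-coboundaries `g ↦ g • x - x`. -/
def B1 (χ : Γ →* Aˣ) (H : Subgroup Γ) : AddSubgroup (H → A) where
  carrier := {f | ∃ x : A, ∀ g : H, f g = (χ g : A) * x - x}
  zero_mem' := ⟨0, by simp⟩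
  add_mem' := by
    rintro f₁ f₂ ⟨x, hx⟩ ⟨y, hy⟩
    refine ⟨x + y, fun g => ?_⟩
    simp only [Pi.add_apply, hx, hy]
    ring
  neg_mem' := by
    rintro f ⟨x, hx⟩
    refine ⟨-x, fun g => ?_⟩
    simp only [Pi.neg_apply, hx]
    ring

/-- The continuous cohomology group `H¹(H, A)`, where `Γ` acts on the discrete module `A`
through `χ`. -/
def H1 (χ : Γ →* Aˣ) (H : Subgroup Γ) : Type _ :=
  Z1 χ H ⧸ (B1 χ H).addSubgroupOf (Z1 χ H)

noncomputable instance (χ : Γ →* Aˣ) (H : Subgroup Γ) : AddCommGroup (H1 χ H) :=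
  inferInstanceAs (AddCommGroup (Z1 χ H ⧸ (B1 χ H).addSubgroupOf (Z1 χ H)))

/-- The cohomology class of a continuous cocycle. -/
def H1.mk (χ : Γ →* Aˣ) (H : Subgroup Γ) : Z1 χ H →+ H1 χ H :=
  QuotientAddGroup.mk' ((B1 χ H).addSubgroupOf (Z1 χ H))

/-- A homomorphism of cocycle groups that preserves coboundaries induces a homomorphism in
cohomology. -/
def H1.lift {Γ' : Type*} [Group Γ'] [TopologicalSpace Γ'] {A' : Type*} [CommRing A']
    {χ : Γ →* Aˣ} {H : Subgroup Γ} {χ' : Γ' →* A'ˣ} {H' : Subgroup Γ'}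
    (φ : Z1 χ H →+ Z1 χ' H')
    (hφ : ∀ f : Z1 χ H, (f : H → A) ∈ B1 χ H → (φ f : H' → A') ∈ B1 χ' H') :
    H1 χ H →+ H1 χ' H' :=
  QuotientAddGroup.map _ _ φ fun f hf => AddSubgroup.mem_addSubgroupOf.2
    (hφ f (AddSubgroup.mem_addSubgroupOf.1 hf))

/-- Change of coefficients along a ring homomorphism `π` compatible with the characters. -/
def coeffMap {B : Type*} [CommRing B] (χ : Γ →* Aˣ) (ψ : Γ →* Bˣ) (π : A →+* B)
    (hπ : ∀ g, π (χ g) = ψ g) (H : Subgroup Γ) : H1 χ H →+ H1 ψ H :=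
  H1.lift
    { toFun := fun f => ⟨fun h => π (f.1 h), f.2.1.comp π, fun g h => by
        beta_reduce
        rw [f.2.2, map_add, map_mul, hπ]⟩
      map_zero' := by ext; simp
      map_add' := fun f₁ f₂ => by ext; simp }
    (by
      rintro f ⟨x, hx⟩
      exact ⟨π x, fun g => by simp [hx, hπ]⟩)

/-- The conjugation action of `Γ` on the cocycles of a normal subgroup:
`(σ • f) h = σ • f (σ⁻¹ h σ)`. -/
def conjZ1 [IsTopologicalGroup Γ] (χ : Γ →* Aˣ) (N : Subgroup Γ) [N.Normal] (σ : Γ) :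
    Z1 χ N →+ Z1 χ N where
  toFun f := ⟨fun h => (χ σ : A) * f.1 (MulAut.conjNormal σ⁻¹ h), by
    constructor
    · refine IsLocallyConstant.comp (f := fun h : N => f.1 (MulAut.conjNormal σ⁻¹ h)) ?_
        (fun a => (χ σ : A) * a)
      refine f.2.1.comp_continuous (Continuous.subtype_mk (f := fun h : N => σ⁻¹ * h * σ⁻¹⁻¹) ?_ _)
      fun_prop
    · intro g h
      have key : (χ (MulAut.conjNormal σ⁻¹ g : N) : A) = (χ g : A) := by
        simp [mul_comm]
      beta_reduce
      rw [map_mul, f.2.2, key]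
      ring⟩
  map_zero' := by ext; simp
  map_add' f₁ f₂ := by ext; simp [mul_add]

/-- The action of `Γ` on `H¹(N, A)`, for `N` a normal subgroup of `Γ`. -/
def conj [IsTopologicalGroup Γ] (χ : Γ →* Aˣ) (N : Subgroup Γ) [N.Normal] :
    Γ →* AddMonoid.End (H1 χ N) where
  toFun σ := H1.lift (conjZ1 χ N σ) (by
    rintro f ⟨x, hx⟩
    refine ⟨(χ σ : A) * x, fun g => ?_⟩
    have key : (χ (MulAut.conjNormal σ⁻¹ g : N) : A) = (χ g : A) := by
      simp [mul_comm]
    change (χ σ : A) * f.1 (MulAut.conjNormal σ⁻¹ g) = _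
    rw [hx, key]
    ring)
  map_one' := by
    ext x
    induction x using QuotientAddGroup.induction_on with
    | H f =>
      refine congrArg (H1.mk χ N) (Subtype.ext (funext fun h => ?_))
      simp [conjZ1]
  map_mul' σ τ := by
    ext x
    induction x using QuotientAddGroup.induction_on with
    | H f =>
      refine congrArg (H1.mk χ N) (Subtype.ext (funext fun h => ?_))
      simp [conjZ1, mul_assoc]

/-- For subgroups `U`, `H` of `Γ`, an element `h` of `H` and a left coset `q` of `H ∩ U` in `H`
with representative `s q`, the element `s (h q)⁻¹ * h * s q` of `U`. -/
noncomputable def cosetShift {Γ : Type*} [Group Γ] (U H : Subgroup Γ) (h : H) (q : H ⧸ U.subgroupOf H) : U :=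
  ⟨((h • q).out⁻¹ * h * q.out : H), by
    have : ((h • q).out : H)⁻¹ * (h * q.out) ∈ U.subgroupOf H := by
      rw [← QuotientGroup.eq, QuotientGroup.out_eq']
      conv_lhs => rw [← QuotientGroup.out_eq' q]
      rfl
    rw [← mul_assoc] at this
    exact this⟩

theorem cosetShift_mul {Γ : Type*} [Group Γ] (U H : Subgroup Γ) (g h : H) (q : H ⧸ U.subgroupOf H) :
    cosetShift U H (g * h) q = cosetShift U H g (h • q) * cosetShift U H h q := by
  apply Subtype.ext
  simp [cosetShift, mul_smul, mul_assoc]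

theorem coe_cosetShift {Γ : Type*} [Group Γ] (U H : Subgroup Γ) (h : H) (q : H ⧸ U.subgroupOf H) :
    (((h • q).out : H) : Γ) * (cosetShift U H h q : Γ) = h * (q.out : H) := by
  simp [cosetShift, mul_assoc]

theorem isLocallyConstant_smul [IsTopologicalGroup Γ] (U H : Subgroup Γ)
    (hU : IsOpen (U : Set Γ)) (q : H ⧸ U.subgroupOf H) :
    IsLocallyConstant (fun h : H => h • q) := by
  have ho : IsOpen (U.subgroupOf H : Set H) := hU.preimage continuous_subtype_val
  have := QuotientGroup.discreteTopology ho
  rw [IsLocallyConstant.iff_continuous]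
  have : (fun h : H => h • q) = fun h : H => ((h * q.out : H) : H ⧸ U.subgroupOf H) := by
    funext h
    conv_lhs => rw [← QuotientGroup.out_eq' q]
    rfl
  rw [this]
  exact QuotientGroup.continuous_mk.comp (by fun_prop)

theorem continuous_cosetShift [IsTopologicalGroup Γ] (U H : Subgroup Γ)
    (hU : IsOpen (U : Set Γ)) (q : H ⧸ U.subgroupOf H) :
    Continuous (fun h : H => cosetShift U H h q) := by
  refine Continuous.subtype_mk (f := fun h : H => (((h • q).out⁻¹ * h * q.out : H) : Γ)) ?_ _
  have h1 : Continuous fun h : H => ((h • q).out : H) :=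
    ((isLocallyConstant_smul U H hU q).comp Quotient.out).continuous
  fun_prop

/-- Corestriction of cocycles from an open subgroup `U` to `H` (with `H ∩ U` of finite index
in `H`): `(cor f) h = ∑ s (h q) • f (s (h q)⁻¹ h s q)`, the sum being over the left cosets `q`
of `H ∩ U` in `H` with representatives `s q`. -/
noncomputable def corZ1 [IsTopologicalGroup Γ] (χ : Γ →* Aˣ) (U H : Subgroup Γ)
    (hU : IsOpen (U : Set Γ)) [Finite (H ⧸ U.subgroupOf H)] : Z1 χ U →+ Z1 χ H where
  toFun f := ⟨fun h => ∑ᶠ q : H ⧸ U.subgroupOf H,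
      (χ ((h • q).out : H) : A) * f.1 (cosetShift U H h q), by
    have := Fintype.ofFinite (H ⧸ U.subgroupOf H)
    simp only [finsum_eq_sum_of_fintype]
    constructor
    · have (s : Finset (H ⧸ U.subgroupOf H)) : IsLocallyConstant fun h : H => ∑ q ∈ s,
          (χ ((h • q).out : H) : A) * f.1 (cosetShift U H h q) := by
        classical
        induction s using Finset.induction_on with
        | empty => exact IsLocallyConstant.const (0 : A)
        | insert q s hq ih =>
          simp only [Finset.sum_insert hq]
          refine IsLocallyConstant.add (IsLocallyConstant.mul ?_ ?_) ih
          · exact (isLocallyConstant_smul U H hU q).comp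
              (fun q' : H ⧸ U.subgroupOf H => (χ (q'.out : H) : A))
          · exact f.2.1.comp_continuous (continuous_cosetShift U H hU q)
      exact this Finset.univ
    · intro g h
      have h1 : ∑ q : H ⧸ U.subgroupOf H, (χ ((g • q).out : H) : A) * f.1 (cosetShift U H g q)
          = ∑ q : H ⧸ U.subgroupOf H, (χ ((g • (h • q)).out : H) : A) *
            f.1 (cosetShift U H g (h • q)) :=
        (Equiv.sum_comp (MulAction.toPerm h) (fun q : H ⧸ U.subgroupOf H =>
          (χ ((g • q).out : H) : A) * f.1 (cosetShift U H g q))).symm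
      beta_reduce
      rw [h1, Finset.mul_sum, ← Finset.sum_add_distrib]
      refine Finset.sum_congr rfl fun q _ => ?_
      have h2 : (χ ((g • (h • q)).out : H) : A) * (χ (cosetShift U H g (h • q)) : A) =
          (χ g : A) * (χ ((h • q).out : H) : A) := by
        rw [← Units.val_mul, ← Units.val_mul, ← map_mul, ← map_mul, coe_cosetShift]
      rw [cosetShift_mul, f.2.2, mul_smul, mul_add, ← mul_assoc, ← mul_assoc, h2]⟩
  map_zero' := by ext; simp
  map_add' f₁ f₂ := by
    have := Fintype.ofFinite (H ⧸ U.subgroupOf H)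
    ext
    simp [finsum_eq_sum_of_fintype, mul_add, Finset.sum_add_distrib]

/-- Corestriction `H¹(U, A) → H¹(H, A)`. -/
noncomputable def cor [IsTopologicalGroup Γ] (χ : Γ →* Aˣ) (U H : Subgroup Γ)
    (hU : IsOpen (U : Set Γ)) [Finite (H ⧸ U.subgroupOf H)] : H1 χ U →+ H1 χ H :=
  H1.lift (corZ1 χ U H hU) (by
    rintro f ⟨x, hx⟩
    have := Fintype.ofFinite (H ⧸ U.subgroupOf H)
    refine ⟨∑ q : H ⧸ U.subgroupOf H, (χ (q.out : H) : A) * x, fun h => ?_⟩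
    change ∑ᶠ q : H ⧸ U.subgroupOf H, (χ ((h • q).out : H) : A) * f.1 (cosetShift U H h q) = _
    have h1 : ∑ q : H ⧸ U.subgroupOf H, (χ (q.out : H) : A) * x
        = ∑ q : H ⧸ U.subgroupOf H, (χ ((h • q).out : H) : A) * x :=
      (Equiv.sum_comp (MulAction.toPerm h) (fun q : H ⧸ U.subgroupOf H =>
        (χ (q.out : H) : A) * x)).symm
    conv_rhs => rw [Finset.mul_sum, h1, ← Finset.sum_sub_distrib]
    rw [finsum_eq_sum_of_fintype]
    refine Finset.sum_congr rfl fun q _ => ?_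
    have h2 : (χ ((h • q).out : H) : A) * (χ (cosetShift U H h q) : A) =
        (χ h : A) * (χ (q.out : H) : A) := by
      rw [← Units.val_mul, ← Units.val_mul, ← map_mul, ← map_mul, coe_cosetShift]
    rw [hx, mul_sub, ← mul_assoc, h2, mul_assoc])

end

end ContH1

/-! ### Cyclotomic fields inside the algebraic closure of `ℚ` in `ℂ` -/

namespace CycloElt

/-- The algebraic closure of `ℚ` in `ℂ`. -/
abbrev Qbar : Type := algebraicClosure ℚ ℂ

instance : IsAlgClosure ℚ Qbar := algebraicClosure.isAlgClosure ℚ ℂ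

instance : IsAlgClosed Qbar := IsAlgClosure.isAlgClosed ℚ

instance : Normal ℚ Qbar := IsAlgClosure.normal ℚ Qbar

/-- `ζ_n = exp(2πi/n)`. -/
noncomputable def zeta (n : ℕ) [NeZero n] : Qbar :=
  ⟨Complex.exp (2 * Real.pi * Complex.I / n),
    mem_algebraicClosure_iff.2
      (((Complex.isPrimitiveRoot_exp n (NeZero.ne n)).isIntegral (NeZero.pos n)).tower_top
        (A := ℚ)).isAlgebraic⟩

theorem zeta_primitive (n : ℕ) [NeZero n] : IsPrimitiveRoot (zeta n) n :=
  IsPrimitiveRoot.coe_submonoidClass_iff.1 (Complex.isPrimitiveRoot_exp n (NeZero.ne n))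

theorem zeta_mul_pow (b n : ℕ) [NeZero b] [NeZero n] : zeta (b * n) ^ b = zeta n := by
  apply Subtype.ext
  change Complex.exp _ ^ b = Complex.exp _
  rw [← Complex.exp_nat_mul]
  congr 1
  have hb : (b : ℂ) ≠ 0 := Nat.cast_ne_zero.2 (NeZero.ne b)
  have hn : (n : ℂ) ≠ 0 := Nat.cast_ne_zero.2 (NeZero.ne n)
  push_cast
  field_simp

/-- The cyclotomic field `ℚ(ζ_n)`. -/
noncomputable def cyc (n : ℕ) [NeZero n] : IntermediateField ℚ Qbar :=
  IntermediateField.adjoin ℚ {zeta n}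

theorem zeta_mem_cyc (n : ℕ) [NeZero n] : zeta n ∈ cyc n :=
  IntermediateField.mem_adjoin_simple_self ℚ (zeta n)

instance (n : ℕ) [NeZero n] : FiniteDimensional ℚ (cyc n) :=
  IntermediateField.adjoin.finiteDimensional (((zeta_primitive n).isIntegral (NeZero.pos n)).tower_top)

/-- The field `ℚ(ζ_{b p^∞})`, the union of the fields `ℚ(ζ_{b p^n})`. -/
noncomputable def cycInf (p : ℕ) [Fact p.Prime] (b : ℕ) [NeZero b] : IntermediateField ℚ Qbar :=
  ⨆ n : ℕ, cyc (b * p ^ n)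

/-- The conductor of an abelian number field `F`: the least `f ≥ 1` with `F ⊆ ℚ(ζ_f)`. -/
noncomputable def conductor (F : IntermediateField ℚ Qbar) : ℕ :=
  sInf {f : ℕ | ∃ _ : NeZero f, F ≤ cyc f}

/-- The field `F_n = F(ζ_{p^n})`. -/
noncomputable def layer (F : IntermediateField ℚ Qbar) (p : ℕ) [Fact p.Prime] (n : ℕ) :
    IntermediateField ℚ Qbar :=
  F ⊔ cyc (p ^ n)

instance (F : IntermediateField ℚ Qbar) [FiniteDimensional ℚ F] (p : ℕ) [Fact p.Prime] (n : ℕ) :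
    FiniteDimensional ℚ (layer F p n) :=
  inferInstanceAs (FiniteDimensional ℚ (F ⊔ cyc (p ^ n) : IntermediateField ℚ Qbar))

theorem cyc_mono (p : ℕ) [Fact p.Prime] {m n : ℕ} (h : m ≤ n) : cyc (p ^ m) ≤ cyc (p ^ n) := by
  obtain ⟨k, rfl⟩ := Nat.exists_eq_add_of_le' h
  refine IntermediateField.adjoin_simple_le_iff.2 ?_
  have := zeta_mul_pow (p ^ k) (p ^ m)
  rw [← this]
  have h2 : zeta (p ^ k * p ^ m) = zeta (p ^ (k + m)) := by
    congr 1
    exact (pow_add p k m).symm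
  rw [h2]
  exact pow_mem (zeta_mem_cyc _) _

theorem layer_mono (F : IntermediateField ℚ Qbar) (p : ℕ) [Fact p.Prime] {m n : ℕ} (h : m ≤ n) :
    layer F p m ≤ layer F p n :=
  sup_le_sup_left (cyc_mono p h) F

/-! ### `p`-units -/

/-- `x` is integral over `ℤ[1/p]`. -/
def IsPIntegral (p : ℕ) (x : Qbar) : Prop :=
  ∃ k : ℕ, IsIntegral ℤ ((p : Qbar) ^ k * x)

theorem IsPIntegral.mul {p : ℕ} {x y : Qbar} (hx : IsPIntegral p x) (hy : IsPIntegral p y) :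
    IsPIntegral p (x * y) := by
  obtain ⟨k, hk⟩ := hx
  obtain ⟨l, hl⟩ := hy
  refine ⟨k + l, ?_⟩
  have : (p : Qbar) ^ (k + l) * (x * y) = (p ^ k * x) * (p ^ l * y) := by ring
  rw [this]
  exact hk.mul hl

/-- The group of `p`-units of the field `K`: the elements of `Kˣ` which are, together with their
inverse, integral over `ℤ[1/p]`. -/
def pUnits (p : ℕ) (K : IntermediateField ℚ Qbar) : Subgroup Qbarˣ where
  carrier := {u | (u : Qbar) ∈ K ∧ IsPIntegral p u ∧ IsPIntegral p (u⁻¹ : Qbarˣ)}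
  one_mem' := ⟨by simp, ⟨0, by simpa using isIntegral_one⟩, ⟨0, by simpa using isIntegral_one⟩⟩
  mul_mem' := by
    rintro u v ⟨h1, h2, h3⟩ ⟨h1', h2', h3'⟩
    refine ⟨by simpa using mul_mem h1 h1', by simpa using h2.mul h2', ?_⟩
    rw [mul_inv, Units.val_mul]
    exact h3.mul h3'
  inv_mem' := by
    rintro u ⟨h1, h2, h3⟩
    exact ⟨by simpa using h1, h3, by simpa using h2⟩

theorem pUnits_mono (p : ℕ) {K L : IntermediateField ℚ Qbar} (h : K ≤ L) :
    pUnits p K ≤ pUnits p L :=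
  fun _ hu => ⟨h hu.1, hu.2⟩

/-- The norm `N_{L/K} : L → K` for subfields `K ⊆ L` of `Qbar`. -/
noncomputable def fieldNorm {K L : IntermediateField ℚ Qbar} (h : K ≤ L) : L →* K :=
  Algebra.norm K (S := IntermediateField.extendScalars h)

theorem IsPIntegral.fieldNorm {p : ℕ} [Fact p.Prime] {K L : IntermediateField ℚ Qbar} (h : K ≤ L)
    {x : L} (hx : IsPIntegral p (x : Qbar)) : IsPIntegral p (fieldNorm h x : Qbar) := by
  obtain ⟨k, hk⟩ := hx
  refine ⟨k * Module.finrank K (IntermediateField.extendScalars h), ?_⟩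
  let y : IntermediateField.extendScalars h :=
    algebraMap K (IntermediateField.extendScalars h) ((p : K) ^ k) *
      (show IntermediateField.extendScalars h from x)
  have hy : IsIntegral ℤ y := by
    rw [← isIntegral_algebraMap_iff
      (algebraMap (IntermediateField.extendScalars h) Qbar).injective]
    exact hk
  have h2 : IsIntegral ℤ (Algebra.norm K y) := Algebra.isIntegral_norm K hy
  have h3 : (Algebra.norm K y : Qbar) = (p : Qbar) ^ (k * Module.finrank K
      (IntermediateField.extendScalars h)) * (CycloElt.fieldNorm h x : Qbar) := by
    have h4 : Algebra.norm K y = ((p : K) ^ k) ^ Module.finrank K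
        (IntermediateField.extendScalars h) * CycloElt.fieldNorm h x := by
      rw [← Algebra.norm_algebraMap]
      exact map_mul (Algebra.norm K) _ _
    rw [h4, pow_mul]
    push_cast
    rfl
  rw [← h3]
  exact h2.map (IsScalarTower.toAlgHom ℤ K Qbar)

/-- The norm `N_{L/K}` on `p`-units. -/
noncomputable def unitNorm (p : ℕ) [Fact p.Prime] {K L : IntermediateField ℚ Qbar} (h : K ≤ L)
    (u : pUnits p L) : pUnits p K :=
  ⟨Units.map (K.val : K →* Qbar) (Units.map (fieldNorm h)
      (Units.mk (⟨u.1, u.2.1⟩ : L) ⟨(u.1⁻¹ : Qbarˣ), (inv_mem u.2).1⟩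
        (Subtype.ext (by simp)) (Subtype.ext (by simp)))), by
    refine ⟨?_, ?_, ?_⟩
    · exact (fieldNorm h ⟨u.1, u.2.1⟩).2
    · exact IsPIntegral.fieldNorm h (x := ⟨u.1, u.2.1⟩) u.2.2.1
    · exact IsPIntegral.fieldNorm h (x := ⟨(u.1⁻¹ : Qbarˣ), (inv_mem u.2).1⟩) u.2.2.2⟩

/-- For `n ≥ 1`, the number `1 - ζ_{b p^n}` is nonzero and divides a power of `p`. -/
theorem one_sub_zeta (p : ℕ) [Fact p.Prime] (b : ℕ) [NeZero b] (n : ℕ) (hn : n ≠ 0) :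
    ∃ y : Qbar, IsIntegral ℤ y ∧ (1 - zeta (b * p ^ n)) * y = (p : Qbar) ^ n := by
  have hp1 : 1 < p ^ n := Nat.one_lt_pow hn (Fact.out : p.Prime).one_lt
  obtain ⟨N, hN⟩ : ∃ N, p ^ n = N + 1 + 1 := ⟨p ^ n - 2, by omega⟩
  have hz := zeta_primitive (p ^ n)
  have hint : IsIntegral ℤ (zeta (p ^ n)) := hz.isIntegral (NeZero.pos _)
  have hint' : IsIntegral ℤ (zeta (b * p ^ n)) := (zeta_primitive _).isIntegral (NeZero.pos _)
  have hprod := IsPrimitiveRoot.prod_one_sub_pow_eq_order (n := N + 1) (μ := zeta (p ^ n))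
    (by rw [← hN]; exact hz)
  rw [Finset.prod_range_succ'] at hprod
  refine ⟨(∑ i ∈ Finset.range b, zeta (b * p ^ n) ^ i) *
    ∏ k ∈ Finset.range N, (1 - zeta (p ^ n) ^ (k + 1 + 1)), ?_, ?_⟩
  · exact (IsIntegral.sum _ fun i _ => hint'.pow i).mul
      (IsIntegral.prod _ fun i _ => isIntegral_one.sub (hint.pow _))
  · rw [← mul_assoc, mul_neg_geom_sum, zeta_mul_pow, mul_comm]
    have : ((p : Qbar)) ^ n = ((N + 1 : ℕ) : Qbar) + 1 := by
      have := congrArg (Nat.cast : ℕ → Qbar) hN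
      push_cast at this ⊢
      exact this
    rw [this, ← hprod]
    simp

/-- The `p`-unit `1 - ζ_{b p^n}` of `ℚ(ζ_{b p^n})`, for `n ≥ 1`. -/
noncomputable def oneSubZeta (p : ℕ) [Fact p.Prime] (b : ℕ) [NeZero b] (n : ℕ) (hn : n ≠ 0) :
    pUnits p (cyc (b * p ^ n)) :=
  ⟨Units.mk0 (1 - zeta (b * p ^ n)) (by
      obtain ⟨y, -, hy⟩ := one_sub_zeta p b n hn
      refine left_ne_zero_of_mul (b := y) ?_
      rw [hy]
      exact pow_ne_zero _ (Nat.cast_ne_zero.2 (NeZero.ne p))), by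
    obtain ⟨y, hy, hy'⟩ := one_sub_zeta p b n hn
    have hp : (p : Qbar) ^ n ≠ 0 := pow_ne_zero _ (Nat.cast_ne_zero.2 (NeZero.ne p))
    have h0 : (1 - zeta (b * p ^ n)) ≠ 0 := left_ne_zero_of_mul (b := y) (by rw [hy']; exact hp)
    refine ⟨sub_mem (one_mem _) (zeta_mem_cyc _), ⟨0, ?_⟩, ⟨n, ?_⟩⟩
    · simpa using isIntegral_one.sub ((zeta_primitive (b * p ^ n)).isIntegral (NeZero.pos _))
    · have : (p : Qbar) ^ n * (1 - zeta (b * p ^ n))⁻¹ = y := by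
        rw [← hy']
        field_simp
      rw [Units.val_inv_eq_inv_val, Units.val_mk0, this]
      exact hy⟩

/-- The norm of `1 - ζ_{b p^n}` from `ℚ(ζ_{b p^n})` to `F_n ∩ ℚ(ζ_{b p^n})`, as a `p`-unit
of `F_n`. -/
noncomputable def epsTop (F : IntermediateField ℚ Qbar) (p : ℕ) [Fact p.Prime] (b : ℕ) [NeZero b]
    (n : ℕ) (hn : n ≠ 0) : pUnits p (layer F p n) :=
  Subgroup.inclusion (pUnits_mono p inf_le_left)
    (unitNorm p (inf_le_right : layer F p n ⊓ cyc (b * p ^ n) ≤ cyc (b * p ^ n))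
      (oneSubZeta p b n hn))

/-- The norm coherent sequence `ε_b^F = (ε_{b,n}^F)_n` of `p`-units of the fields `F_n`, where
`p ^ a` is the `p`-part of the conductor of `F`: the element `ε_{b,n}^F` is the norm of
`1 - ζ_{b p^n}` for `n ≥ max a 1`, and the norm of the element of level `max a 1` for smaller
`n`. -/
noncomputable def eps (F : IntermediateField ℚ Qbar) (p : ℕ) [Fact p.Prime] (a b : ℕ) [NeZero b]
    (n : ℕ) : pUnits p (layer F p n) :=
  if h : max a 1 ≤ n then epsTop F p b n (by omega)
  else unitNorm p (layer_mono F p (not_le.1 h).le) (epsTop F p b (max a 1) (by omega))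

/-! ### The maximal extension unramified outside `p` and its Galois group -/

/-- The field `Ω_S`, the maximal extension of `F` in `Qbar` which is unramified at all primes not
dividing `p`: the subfield fixed by the inertia groups in `Gal(Qbar/F)` of all the maximal ideals
of the ring of algebraic integers that do not contain `p`. -/
noncomputable def Omega (F : IntermediateField ℚ Qbar) (p : ℕ) : IntermediateField ℚ Qbar :=
  IntermediateField.fixedField
    (⨆ 𝔓 : {𝔓 : Ideal (NumberField.RingOfIntegers Qbar) //
        𝔓.IsMaximal ∧ (p : NumberField.RingOfIntegers Qbar) ∉ 𝔓},
      F.fixingSubgroup ⊓ 𝔓.1.toAddSubgroup.inertia Gal(Qbar/ℚ))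

theorem mem_Omega_iff {F : IntermediateField ℚ Qbar} {p : ℕ} {x : Qbar} :
    x ∈ Omega F p ↔ ∀ 𝔓 : Ideal (NumberField.RingOfIntegers Qbar), 𝔓.IsMaximal →
      (p : NumberField.RingOfIntegers Qbar) ∉ 𝔓 → ∀ σ ∈ F.fixingSubgroup,
      σ ∈ 𝔓.toAddSubgroup.inertia Gal(Qbar/ℚ) → σ x = x := by
  rw [Omega, IntermediateField.mem_fixedField_iff]
  constructor
  · intro h 𝔓 h1 h2 σ hσ hσ'
    exact h σ (Subgroup.mem_iSup_of_mem (⟨𝔓, h1, h2⟩ : {𝔓 : Ideal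
      (NumberField.RingOfIntegers Qbar) // 𝔓.IsMaximal ∧
        (p : NumberField.RingOfIntegers Qbar) ∉ 𝔓}) ⟨hσ, hσ'⟩)
  · intro h
    have : (⨆ 𝔓 : {𝔓 : Ideal (NumberField.RingOfIntegers Qbar) //
        𝔓.IsMaximal ∧ (p : NumberField.RingOfIntegers Qbar) ∉ 𝔓},
      F.fixingSubgroup ⊓ 𝔓.1.toAddSubgroup.inertia Gal(Qbar/ℚ)) ≤
        MulAction.stabilizer Gal(Qbar/ℚ) x :=
      iSup_le fun 𝔓 σ hσ => h 𝔓.1 𝔓.2.1 𝔓.2.2 σ hσ.1 hσ.2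
    exact fun σ hσ => this hσ

theorem isIntegral_Omega {F : IntermediateField ℚ Qbar} {p : ℕ} (x : Omega F p) :
    IsIntegral ℚ x :=
  (isIntegral_algebraMap_iff (algebraMap (Omega F p) Qbar).injective).1
    (Algebra.IsIntegral.isIntegral (x : Qbar))

theorem le_Omega (F : IntermediateField ℚ Qbar) (p : ℕ) : F ≤ Omega F p :=
  fun x hx => mem_Omega_iff.2 fun _ _ _ σ hσ _ =>
    (IntermediateField.mem_fixingSubgroup_iff F σ).1 hσ x hx

/-- Extracting a `p ^ m`-th root of a `p`-unit is unramified outside `p`. -/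
theorem root_mem_Omega {F : IntermediateField ℚ Qbar} {p : ℕ} [Fact p.Prime] {m : ℕ}
    {u w : Qbarˣ} (hu : u ∈ pUnits p (Omega F p)) (hw : w ^ p ^ m = u) :
    (w : Qbar) ∈ Omega F p := by
  rw [mem_Omega_iff]
  intro 𝔓 h𝔓 hp σ hσ hσ'
  have hσu : σ (u : Qbar) = u := mem_Omega_iff.1 hu.1 𝔓 h𝔓 hp σ hσ hσ'
  obtain ⟨-, ⟨k, hk⟩, ⟨l, hl⟩⟩ := hu
  have hN : 1 ≤ p ^ m := NeZero.one_le
  have hw' : (w : Qbar) ^ p ^ m = u := by rw [← hw]; simp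
  have hint (k : ℕ) (v t : Qbar) (hv : t ^ p ^ m = v) (h : IsIntegral ℤ ((p : Qbar) ^ k * v)) :
      IsIntegral ℤ ((p : Qbar) ^ k * t) := by
    refine IsIntegral.of_pow (n := p ^ m) (by omega) ?_
    obtain ⟨N, hN⟩ : ∃ N, p ^ m = N + 1 := ⟨p ^ m - 1, by omega⟩
    have : ((p : Qbar) ^ k * t) ^ p ^ m = (p : Qbar) ^ (k * N) * (p ^ k * v) := by
      rw [mul_pow, hv, hN, ← pow_mul, mul_add, mul_one, pow_add]
      ring
    rw [this]
    exact (((isIntegral_algebraMap (R := ℤ) (x := (p : ℤ))).pow (k * N)).mul h : _)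
  have hy := hint k u w hw' hk
  have hz := hint l (u⁻¹ : Qbarˣ) (w⁻¹ : Qbarˣ) (by rw [← hw]; simp) hl
  set η : Qbar := σ (w : Qbar) * (w⁻¹ : Qbarˣ) with hη
  have hη1 : η ^ p ^ m = 1 := by
    rw [hη, mul_pow, ← map_pow, hw', hσu, ← hw', ← mul_pow]
    simp
  have hση : σ (w : Qbar) = η * w := by simp [hη]
  by_cases hone : η = 1
  · rw [hση, hone, one_mul]
  exfalso
  -- the element `η - 1` lies in `𝔓`
  have hηint : IsIntegral ℤ η := IsIntegral.of_pow (n := p ^ m) (by omega)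
    (by rw [hη1]; exact isIntegral_one)
  let Y : NumberField.RingOfIntegers Qbar := ⟨_, hy⟩
  let Z : NumberField.RingOfIntegers Qbar := ⟨_, hz⟩
  let E : NumberField.RingOfIntegers Qbar := ⟨η, hηint⟩
  have hmem : σ • Y - Y ∈ 𝔓 := hσ' Y
  have hmem2 : (E - 1) * (p : NumberField.RingOfIntegers Qbar) ^ (k + l) ∈ 𝔓 := by
    have : (E - 1) * (p : NumberField.RingOfIntegers Qbar) ^ (k + l) = (σ • Y - Y) * Z := by
      apply NumberField.RingOfIntegers.ext
      change (η - 1) * (p : Qbar) ^ (k + l) =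
        (σ ((p : Qbar) ^ k * w) - (p : Qbar) ^ k * w) * ((p : Qbar) ^ l * (w⁻¹ : Qbarˣ))
      rw [map_mul, map_pow, map_natCast, hση]
      have : (w : Qbar) * (w⁻¹ : Qbarˣ) = 1 := by simp
      linear_combination (-(η - 1) * (p : Qbar) ^ (k + l)) * this
    rw [this]
    exact Ideal.mul_mem_right _ _ hmem
  have hE : E - 1 ∈ 𝔓 := (h𝔓.isPrime.mem_or_mem hmem2).resolve_right
    fun h => hp (h𝔓.isPrime.mem_of_pow_mem _ h)
  -- the order of `η` is a nontrivial power of `p`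
  obtain ⟨j, -, hj⟩ := (Nat.dvd_prime_pow Fact.out).1 (orderOf_dvd_of_pow_eq_one hη1)
  have hj0 : j ≠ 0 := by
    rintro rfl
    exact hone (orderOf_eq_one_iff.1 (by simpa using hj))
  have hp1 : 1 < p ^ j := Nat.one_lt_pow hj0 (Fact.out : p.Prime).one_lt
  obtain ⟨N, hN⟩ : ∃ N, p ^ j = N + 1 + 1 := ⟨p ^ j - 2, by omega⟩
  have hprim : IsPrimitiveRoot E (N + 1 + 1) := by
    refine IsPrimitiveRoot.of_map_of_injective
      (f := algebraMap (NumberField.RingOfIntegers Qbar) Qbar) ?_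
      NumberField.RingOfIntegers.coe_injective
    rw [← hN, ← hj]
    exact IsPrimitiveRoot.orderOf η
  have hprod := IsPrimitiveRoot.prod_one_sub_pow_eq_order hprim
  have hpj : ((p : NumberField.RingOfIntegers Qbar)) ^ j ∈ 𝔓 := by
    have h1 : (p : NumberField.RingOfIntegers Qbar) ^ j = ((N + 1 : ℕ) : _) + 1 := by
      have := congrArg (Nat.cast : ℕ → NumberField.RingOfIntegers Qbar) hN
      push_cast at this ⊢
      exact this
    rw [h1, ← hprod, Finset.prod_range_succ']
    refine Ideal.mul_mem_left _ _ ?_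
    have := neg_mem hE
    simpa using this
  exact hp (h𝔓.isPrime.mem_of_pow_mem _ hpj)

theorem zeta_mem_Omega (F : IntermediateField ℚ Qbar) (p : ℕ) [Fact p.Prime] (m : ℕ) :
    zeta (p ^ m) ∈ Omega F p :=
  root_mem_Omega (u := 1) (m := m)
    (w := Units.mk0 (zeta (p ^ m)) ((zeta_primitive (p ^ m)).ne_zero (NeZero.ne _)))
    (one_mem _) (Units.ext (by simpa using (zeta_primitive (p ^ m)).pow_eq_one))

theorem layer_le_Omega (F : IntermediateField ℚ Qbar) (p : ℕ) [Fact p.Prime] (m : ℕ) :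
    layer F p m ≤ Omega F p :=
  sup_le (le_Omega F p) (IntermediateField.adjoin_simple_le_iff.2 (zeta_mem_Omega F p m))

instance (F : IntermediateField ℚ Qbar) (p : ℕ) [Fact p.Prime] (m : ℕ) :
    HasEnoughRootsOfUnity (Omega F p) (p ^ m) :=
  ⟨⟨⟨zeta (p ^ m), zeta_mem_Omega F p m⟩,
    IsPrimitiveRoot.coe_submonoidClass_iff.1 (zeta_primitive (p ^ m))⟩,
    rootsOfUnity.isCyclic _ _⟩

/-- For `𝒢_S = Gal(Ω_S/ℚ)` and a subfield `K` of `Ω_S`, the subgroup `Gal(Ω_S/K)` of `𝒢_S`.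
For `K = F` this is `G_S`, and for `K = F_n` it is `G_S(F_n)`. -/
noncomputable def galOver (F : IntermediateField ℚ Qbar) (p : ℕ) (K : IntermediateField ℚ Qbar) :
    Subgroup Gal(Omega F p/ℚ) :=
  (K.comap (Omega F p).val).fixingSubgroup

theorem mem_galOver_iff {F : IntermediateField ℚ Qbar} {p : ℕ} {K : IntermediateField ℚ Qbar}
    {σ : Gal(Omega F p/ℚ)} :
    σ ∈ galOver F p K ↔ ∀ x : Omega F p, (x : Qbar) ∈ K → σ x = x :=
  IntermediateField.mem_fixingSubgroup_iff _ _

instance (F : IntermediateField ℚ Qbar) (p : ℕ) (K : IntermediateField ℚ Qbar) [Normal ℚ K] :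
    (galOver F p K).Normal := by
  refine ⟨fun n hn σ => mem_galOver_iff.2 fun x hx => ?_⟩
  have hK : ∀ (τ : Gal(Omega F p/ℚ)) (y : Omega F p), (y : Qbar) ∈ K → (τ y : Qbar) ∈ K := by
    intro τ y hy
    have h1 := IntermediateField.normal_iff_forall_fieldRange_le.1 ‹Normal ℚ K›
    obtain ⟨T, hT⟩ : ∃ T : Qbar →ₐ[ℚ] Qbar, ∀ z : Omega F p, T z = τ z := by
      let f : Omega F p →ₐ[ℚ] Qbar := (Omega F p).val.comp τ.toAlgHom
      exact ⟨f.liftNormal Qbar, fun z => f.liftNormal_commutes Qbar z⟩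
    rw [← hT]
    exact h1 (T.comp K.val) ⟨⟨y, hy⟩, rfl⟩
  have h := mem_galOver_iff.1 hn (σ⁻¹ x) (hK σ⁻¹ x hx)
  change σ (n (σ⁻¹ x)) = x
  rw [h]
  exact σ.apply_symm_apply x

instance (F : IntermediateField ℚ Qbar) (p : ℕ) (K : IntermediateField ℚ Qbar)
    [FiniteDimensional ℚ K] : FiniteDimensional ℚ (K.comap (Omega F p).val) :=
  FiniteDimensional.of_injective
    (V₂ := K) (LinearMap.codRestrict (Subalgebra.toSubmodule K.toSubalgebra)
      (((Omega F p).val.comp (K.comap (Omega F p).val).val).toLinearMap) fun x => x.2)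
    fun _ _ h => Subtype.ext (Subtype.ext (congrArg (fun z : K => (z : Qbar)) h))

theorem isOpen_galOver (F : IntermediateField ℚ Qbar) (p : ℕ) (K : IntermediateField ℚ Qbar)
    [FiniteDimensional ℚ K] : IsOpen (galOver F p K : Set Gal(Omega F p/ℚ)) :=
  IntermediateField.fixingSubgroup_isOpen _

instance (F : IntermediateField ℚ Qbar) (p : ℕ) (K : IntermediateField ℚ Qbar)
    [FiniteDimensional ℚ K] : (galOver F p K).FiniteIndex := by
  let K' := K.comap (Omega F p).val
  let φ : Gal(Omega F p/ℚ) → (K' →ₐ[ℚ] Omega F p) := fun σ =>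
    σ.toAlgHom.comp K'.val
  have : Finite (Gal(Omega F p/ℚ) ⧸ galOver F p K) := by
    refine Finite.of_injective (fun q => φ q.out) fun q q' h => ?_
    rw [← QuotientGroup.out_eq' q, ← QuotientGroup.out_eq' q', QuotientGroup.eq]
    refine mem_galOver_iff.2 fun x hx => ?_
    have h2 : q.out x = q'.out x := DFunLike.congr_fun h (⟨x, hx⟩ : K')
    rw [AlgEquiv.mul_apply, ← h2]
    exact q.out.symm_apply_apply x
  exact Subgroup.finiteIndex_of_finite_quotient

/-! ### Tate twists, the Kummer map and the special elements -/

/-- The cyclotomic character `𝒢_S → ℤ_pˣ`. -/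
noncomputable def kappa (F : IntermediateField ℚ Qbar) (p : ℕ) [Fact p.Prime] :
    Gal(Omega F p/ℚ) →* ℤ_[p]ˣ :=
  (cyclotomicCharacter (Omega F p) p).comp
    { toFun := fun σ => (σ : Omega F p ≃+* Omega F p)
      map_one' := rfl
      map_mul' := fun _ _ => rfl }

/-- The character `κ ^ r` modulo `p ^ m`, through which `𝒢_S` acts on `ℤ/p^m(r)`. The module
`ℤ/p^m(r)` is the group `ℤ/p^m`, its element `1` being the generator `t(r)_m` given by the `r`-th
tensor power of `ζ_{p^m}`. -/
noncomputable def twist (F : IntermediateField ℚ Qbar) (p : ℕ) [Fact p.Prime] (r m : ℕ) :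
    Gal(Omega F p/ℚ) →* (ZMod (p ^ m))ˣ :=
  (Units.map (PadicInt.toZModPow (p := p) m).toMonoidHom).comp (kappa F p ^ r)

theorem castHom_twist (F : IntermediateField ℚ Qbar) (p : ℕ) [Fact p.Prime] (r m : ℕ)
    (g : Gal(Omega F p/ℚ)) :
    ZMod.castHom (pow_dvd_pow p m.le_succ) (ZMod (p ^ m)) (twist F p r (m + 1) g) =
      (twist F p r m g : ZMod (p ^ m)) :=
  DFunLike.congr_fun (PadicInt.zmod_cast_comp_toZModPow (p := p) m (m + 1) m.le_succ)
    ((kappa F p ^ r) g : ℤ_[p])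

theorem twist_eq_one {F : IntermediateField ℚ Qbar} {p : ℕ} [Fact p.Prime] (r m : ℕ)
    {g : Gal(Omega F p/ℚ)} (hg : g ∈ galOver F p (layer F p m)) : twist F p r m g = 1 := by
  have hz : IsPrimitiveRoot (⟨zeta (p ^ m), zeta_mem_Omega F p m⟩ : Omega F p) (p ^ m) :=
    IsPrimitiveRoot.coe_submonoidClass_iff.1 (zeta_primitive (p ^ m))
  have h1 := cyclotomicCharacter.spec p (n := m) (g : Omega F p ≃+* Omega F p) _ hz.pow_eq_one
  have h2 : g (⟨zeta (p ^ m), zeta_mem_Omega F p m⟩ : Omega F p) = ⟨zeta (p ^ m), _⟩ :=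
    mem_galOver_iff.1 hg _ ((le_sup_right : cyc (p ^ m) ≤ layer F p m) (zeta_mem_cyc _))
  have h3 : PadicInt.toZModPow m (kappa F p g : ℤ_[p]) = 1 := by
    rcases Nat.eq_zero_or_pos m with rfl | hm
    · have : Subsingleton (ZMod (p ^ 0)) := by
        rw [pow_zero]
        infer_instance
      exact Subsingleton.elim _ _
    have hlt : 1 < p ^ m := Nat.one_lt_pow hm.ne' (Fact.out : p.Prime).one_lt
    have : Fact (1 < p ^ m) := ⟨hlt⟩
    apply ZMod.val_injective
    refine hz.pow_inj (ZMod.val_lt _) (ZMod.val_lt _) ?_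
    rw [ZMod.val_one, pow_one]
    exact h1.symm.trans h2
  ext
  change PadicInt.toZModPow m ((kappa F p g ^ r : ℤ_[p]ˣ) : ℤ_[p]) = 1
  rw [Units.val_pow_eq_pow_val, map_pow, h3, one_pow]

theorem exists_rootLog (N : ℕ) [NeZero N] (x : Qbar) (hx : x ^ N = 1) :
    ∃ k : ZMod N, zeta N ^ k.val = x := by
  obtain ⟨i, hi, h⟩ := (zeta_primitive N).eq_pow_of_pow_eq_one hx
  exact ⟨i, by rw [ZMod.val_cast_of_lt hi, h]⟩

/-- The identification of `μ_N` with `ℤ/N` that sends `ζ_N` to `1`. -/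
noncomputable def rootLog (N : ℕ) [NeZero N] (x : Qbar) (hx : x ^ N = 1) : ZMod N :=
  (exists_rootLog N x hx).choose

theorem zeta_pow_rootLog (N : ℕ) [NeZero N] (x : Qbar) (hx : x ^ N = 1) :
    zeta N ^ (rootLog N x hx).val = x :=
  (exists_rootLog N x hx).choose_spec

theorem rootLog_eq_iff (N : ℕ) [NeZero N] (x : Qbar) (hx : x ^ N = 1) (k : ℕ) :
    rootLog N x hx = k ↔ x = zeta N ^ k := by
  conv_rhs => rw [← zeta_pow_rootLog N x hx]
  let z : Qbarˣ := Units.mk0 (zeta N) ((zeta_primitive N).ne_zero (NeZero.ne N))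
  have hz : orderOf z = N := by
    rw [← orderOf_units, Units.val_mk0, ← (zeta_primitive N).eq_orderOf]
  have h : zeta N ^ (rootLog N x hx).val = zeta N ^ k ↔ z ^ (rootLog N x hx).val = z ^ k := by
    simp [Units.ext_iff, z]
  rw [h, pow_eq_pow_iff_modEq, hz, ← ZMod.natCast_eq_natCast_iff, ZMod.natCast_zmod_val]

theorem exists_root {F : IntermediateField ℚ Qbar} {p : ℕ} [Fact p.Prime] {m : ℕ}
    (u : pUnits p (layer F p m)) : ∃ w : (Omega F p)ˣ, ((w : Omega F p) : Qbar) ^ p ^ m = (u.1 : Qbar) := by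
  obtain ⟨w, hw⟩ := IsAlgClosed.exists_pow_nat_eq (u.1 : Qbar) (NeZero.pos (p ^ m))
  have hw0 : w ≠ 0 := by
    rintro rfl
    rw [zero_pow (NeZero.ne _)] at hw
    exact u.1.ne_zero hw.symm
  have h := root_mem_Omega (F := F) (w := Units.mk0 w hw0) (m := m) (u := u)
    (pUnits_mono p (layer_le_Omega F p m) u.2) (Units.ext (by simpa using hw))
  exact ⟨Units.mk0 ⟨w, h⟩ (fun h' => hw0 (congrArg Subtype.val h')), hw⟩

/-- A chosen `p ^ m`-th root, in `Ω_S`, of a `p`-unit of `F_m`. -/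
noncomputable def root {F : IntermediateField ℚ Qbar} {p : ℕ} [Fact p.Prime] {m : ℕ}
    (u : pUnits p (layer F p m)) : (Omega F p)ˣ :=
  (exists_root u).choose

theorem root_pow {F : IntermediateField ℚ Qbar} {p : ℕ} [Fact p.Prime] {m : ℕ}
    (u : pUnits p (layer F p m)) : ((root u : Omega F p) : Qbar) ^ p ^ m = (u.1 : Qbar) :=
  (exists_root u).choose_spec

theorem root_quotient {F : IntermediateField ℚ Qbar} {p : ℕ} [Fact p.Prime] {m : ℕ}
    (u : pUnits p (layer F p m)) (g : galOver F p (layer F p m)) :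
    ((g.1 (root u : Omega F p) / (root u : Omega F p) : Omega F p) : Qbar) ^ p ^ m = 1 := by
  have h1 : (root u : Omega F p) ^ p ^ m = ⟨u.1, layer_le_Omega F p m u.2.1⟩ :=
    Subtype.ext (by simpa using root_pow u)
  have h2 := mem_galOver_iff.1 g.2 _ (show ((⟨u.1, layer_le_Omega F p m u.2.1⟩ : Omega F p) : Qbar)
    ∈ layer F p m from u.2.1)
  have h3 : (g.1 (root u : Omega F p) / (root u : Omega F p) : Omega F p) ^ p ^ m = 1 := by
    rw [div_pow, ← map_pow, h1, h2, ← h1, div_self]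
    exact pow_ne_zero _ (root u).ne_zero
  simpa using congrArg (Subtype.val) h3

/-- The Kummer cocycle `g ↦ g(u^{1/p^m}) / u^{1/p^m} ⊗ t(r-1)_m` of a `p`-unit `u` of `F_m`, with
values in `μ_{p^m}(r-1) = ℤ/p^m(r)`. -/
noncomputable def kummerZ1 (F : IntermediateField ℚ Qbar) (p : ℕ) [Fact p.Prime] (r m : ℕ)
    (u : pUnits p (layer F p m)) : ContH1.Z1 (twist F p r m) (galOver F p (layer F p m)) :=
  ⟨fun g => rootLog (p ^ m) _ (root_quotient u g), by
    constructor
    · rw [IsLocallyConstant.iff_exists_open]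
      intro g
      let E : IntermediateField ℚ (Omega F p) := IntermediateField.adjoin ℚ {(root u : Omega F p)}
      have hE : FiniteDimensional ℚ E := IntermediateField.adjoin.finiteDimensional
        (isIntegral_Omega _)
      refine ⟨{h | g.1⁻¹ * h.1 ∈ E.fixingSubgroup}, ?_, ?_, ?_⟩
      · exact E.fixingSubgroup_isOpen.preimage (by fun_prop)
      · simp
      · intro h hh
        have h1 := (IntermediateField.mem_fixingSubgroup_iff E _).1 hh _
          (IntermediateField.mem_adjoin_simple_self ℚ (root u : Omega F p))
        have h2 : h.1 (root u : Omega F p) = g.1 (root u : Omega F p) := by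
          rw [AlgEquiv.mul_apply] at h1
          conv_rhs => rw [← h1]
          exact (g.1.apply_symm_apply _).symm
        simp only [h2]
    · intro g h
      beta_reduce
      rw [twist_eq_one r m g.2, Units.val_one, one_mul]
      set a := rootLog (p ^ m) _ (root_quotient u g) with ha
      set b := rootLog (p ^ m) _ (root_quotient u h) with hb
      have hab : a + b = ((a.val + b.val : ℕ) : ZMod (p ^ m)) := by simp
      rw [hab, rootLog_eq_iff, pow_add, ha, hb, zeta_pow_rootLog, zeta_pow_rootLog]
      have hz : g.1 (⟨zeta (p ^ m), zeta_mem_Omega F p m⟩ : Omega F p) = ⟨zeta (p ^ m), _⟩ :=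
        mem_galOver_iff.1 g.2 _ ((le_sup_right : cyc (p ^ m) ≤ layer F p m) (zeta_mem_cyc _))
      have h1 : (h.1 (root u : Omega F p) / (root u : Omega F p) : Omega F p) =
          (⟨zeta (p ^ m), zeta_mem_Omega F p m⟩ : Omega F p) ^ b.val :=
        Subtype.ext ((zeta_pow_rootLog (p ^ m) _ (root_quotient u h)).symm.trans (by simp [hb]))
      have h2 : g.1 (h.1 (root u : Omega F p) / (root u : Omega F p)) =
          (h.1 (root u : Omega F p) / (root u : Omega F p) : Omega F p) := by
        rw [h1, map_pow, hz]
      rw [map_div₀] at h2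
      have hr := (root u).ne_zero
      have hgr : g.1 (root u : Omega F p) ≠ 0 := by simp
      have h3 : ((g * h : galOver F p (layer F p m)) : Gal(Omega F p/ℚ)) (root u : Omega F p) /
          (root u : Omega F p) = (g.1 (root u : Omega F p) / (root u : Omega F p)) *
            (h.1 (root u : Omega F p) / (root u : Omega F p)) := by
        rw [← h2, Subgroup.coe_mul, AlgEquiv.mul_apply]
        field_simp
      rw [h3]
      rfl⟩

/-- The group `H¹(G_S, ℤ/p^m(r))`. -/
abbrev H1Mod (F : IntermediateField ℚ Qbar) (p : ℕ) [Fact p.Prime] (r m : ℕ) : Type :=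
  ContH1.H1 (twist F p r m) (galOver F p F)

/-- The group `H¹(G_S, ℤ_p(r)) = lim H¹(G_S, ℤ/p^m(r))`, as a subgroup of the product of the
groups `H¹(G_S, ℤ/p^m(r))`. -/
noncomputable def H1Zp (F : IntermediateField ℚ Qbar) (p : ℕ) [Fact p.Prime] (r : ℕ) :
    AddSubgroup (∀ m, H1Mod F p r m) where
  carrier := {x | ∀ m, ContH1.coeffMap (twist F p r (m + 1)) (twist F p r m)
    (ZMod.castHom (pow_dvd_pow p m.le_succ) (ZMod (p ^ m))) (castHom_twist F p r m) (galOver F p F)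
    (x (m + 1)) = x m}
  zero_mem' m := by simp
  add_mem' {x y} hx hy m := by simp only [Pi.add_apply, map_add, hx m, hy m]
  neg_mem' {x} hx m := by simp only [Pi.neg_apply, map_neg, hx m]

/-- The action of `σ ∈ 𝒢_S` on families of classes in the groups `H¹(G_S, ℤ/p^m(r))`. On each of
these groups the subgroup `G_S` acts trivially, so that this is the action of
`Gal(F/ℚ) = 𝒢_S / G_S`. -/
noncomputable def act (F : IntermediateField ℚ Qbar) (p : ℕ) [Fact p.Prime] [Normal ℚ F] (r : ℕ)
    (σ : Gal(Omega F p/ℚ)) : (∀ m, H1Mod F p r m) →+ (∀ m, H1Mod F p r m) where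
  toFun x m := ContH1.conj (twist F p r m) (galOver F p F) σ (x m)
  map_zero' := by funext m; simp
  map_add' x y := by funext m; simp

/-- The norm `N_{L/K}`, for subfields `K ⊆ L` of `F`, of an element `x` fixed by `Gal(F/L)`: the
sum of the `σ x`, for `σ` running through lifts of the elements of
`Gal(L/K) = Gal(Ω_S/K) / Gal(Ω_S/L)`. -/
noncomputable def galNorm (F : IntermediateField ℚ Qbar) (p : ℕ) [Fact p.Prime] [Normal ℚ F]
    (r : ℕ) (L K : IntermediateField ℚ Qbar) (x : ∀ m, H1Mod F p r m) : ∀ m, H1Mod F p r m :=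
  ∑ᶠ q : galOver F p K ⧸ (galOver F p L).subgroupOf (galOver F p K),
    act F p r ((q.out : galOver F p K) : Gal(Omega F p/ℚ)) x

/-- The descent map `α` on sequences `u = (u_m)` of `p`-units of the fields `F_m` (twisted by
`t(r-1)`): its component in `H¹(G_S, ℤ/p^m(r))` is the corestriction from `F_m` to `F` of the
class of the Kummer cocycle of `u_m`. -/
noncomputable def alpha (F : IntermediateField ℚ Qbar) [FiniteDimensional ℚ F] (p : ℕ)
    [Fact p.Prime] (r : ℕ) (u : ∀ m, pUnits p (layer F p m)) : ∀ m, H1Mod F p r m :=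
  fun m => ContH1.cor (twist F p r m) (galOver F p (layer F p m)) (galOver F p F)
    (isOpen_galOver F p (layer F p m))
    (ContH1.H1.mk (twist F p r m) (galOver F p (layer F p m)) (kummerZ1 F p r m (u m)))

/-- The special element `c_b^F(r) = α(ε_b^F ⊗ t(r-1))`, where `p ^ a` is the `p`-part of the
conductor of `F`. -/
noncomputable def special (F : IntermediateField ℚ Qbar) [FiniteDimensional ℚ F] (p : ℕ)
    [Fact p.Prime] (a r b : ℕ) [NeZero b] : ∀ m, H1Mod F p r m :=
  alpha F p r (eps F p a b)

/-- `σ ∈ 𝒢_S` induces on `ℚ(ζ_{b p^∞}) ∩ F` the Frobenius `Fr_ℓ`, that is, the restriction of the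
automorphism of `ℚ(ζ_{b p^∞})` that raises the roots of unity `ζ_{b p^n}` to the power `ℓ`. -/
def IsFrobenius (F : IntermediateField ℚ Qbar) (p : ℕ) [Fact p.Prime] (l b : ℕ) [NeZero b]
    (σ : Gal(Omega F p/ℚ)) : Prop :=
  ∃ τ : Gal(Qbar/ℚ), (∀ n : ℕ, τ (zeta (b * p ^ n)) = zeta (b * p ^ n) ^ l) ∧
    ∀ x : Omega F p, (x : Qbar) ∈ cycInf p b ⊓ F → (σ x : Qbar) = τ x

end CycloElt

/-! ### Corestriction, conjugation and change of coefficients -/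

namespace ContH1

section

variable {Γ : Type*} [Group Γ] [TopologicalSpace Γ] {A : Type*} [CommRing A]

/-! For each `m`, taking Kummer classes and corestricting from `F_m` to `F` is a homomorphism
`alphaHom` from the `p`-units of `F_m` to `H¹(G_S, ℤ/p^m(r))`. Two of its properties carry the
proof. By `coeffMap_alphaHom`, the image of a unit `u` of `F_{m+1}`, reduced modulo `p^m`, is the
image of the norm of `u` to `F_m`; so norm coherent sequences give elements of the limit, and
`unitNorm_eps` supplies the coherence. By `conj_alphaHom`, an automorphism `τ` with `τ ζ_{p^m} =
ζ_{p^m}^k` sends the image of `u` to `k^(r-1)` times the image of `τ u`; this is where the factor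
`ℓ^(r-1)` comes from.

In the limit each component determines the lower ones (`H1Zp_ext`), so identities need checking only
at levels `n ≥ max a 1`, where `ε_{b,n}` is directly a norm of `1 - ζ_{bp^n}` and `F_n ⊆
ℚ(ζ_{dp^n})`. An automorphism over `ℚ(ζ_{bp^∞}) ∩ F` is a product `αβ` with `α` over `F` and `β`
fixing `ζ_{bp^n}`. Here `α` acts trivially on cohomology and `β` acts only through the units, with
no twist factor. This yields the invariance.

The same device, in `IsTransversal.layer`, turns the sum over the Galois group into the norm of
units from `F_n ∩ ℚ(ζ_{ℓbp^n})` to `F_n ∩ ℚ(ζ_{bp^n})`. By transitivity it remains to compute the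
norm of `1 - ζ_{ℓbp^n}` to `ℚ(ζ_{bp^n})`. It is `1 - ζ_{bp^n}` if `ℓ ∣ b`, and the quotient of `1 -
ζ_{bp^n}` by its image under the inverse Frobenius otherwise. -/

theorem H1.mk_eq_mk {χ : Γ →* Aˣ} {H : Subgroup Γ} {f g : Z1 χ H} :
    H1.mk χ H f = H1.mk χ H g ↔ ∃ x : A, ∀ h : H, g.1 h - f.1 h = (χ h : A) * x - x := by
  refine QuotientAddGroup.eq.trans ?_
  rw [AddSubgroup.mem_addSubgroupOf, neg_add_eq_sub]
  rfl

theorem H1.mk_surjective (χ : Γ →* Aˣ) (H : Subgroup Γ) : Function.Surjective (H1.mk χ H) :=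
  QuotientAddGroup.mk'_surjective _

theorem Z1_map_one {χ : Γ →* Aˣ} {H : Subgroup Γ} (f : Z1 χ H) : f.1 1 = 0 := by
  have := f.2.2 1 1
  simpa using this

theorem Z1_map_inv {χ : Γ →* Aˣ} {H : Subgroup Γ} (f : Z1 χ H) (u : H) :
    f.1 u⁻¹ = -((χ u)⁻¹ : Aˣ) * f.1 u := by
  have h := f.2.2 u⁻¹ u
  rw [inv_mul_cancel, Z1_map_one f, Subgroup.coe_inv, map_inv] at h
  linear_combination -h

theorem conj_mul_apply [IsTopologicalGroup Γ] (χ : Γ →* Aˣ) (N : Subgroup Γ) [N.Normal] (σ τ : Γ)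
    (x : H1 χ N) : conj χ N (σ * τ) x = conj χ N σ (conj χ N τ x) := by
  rw [map_mul]
  rfl

/-- A normal subgroup acts trivially on its cohomology. -/
theorem conj_eq_self [IsTopologicalGroup Γ] (χ : Γ →* Aˣ) (N : Subgroup Γ) [N.Normal] {σ : Γ}
    (hσ : σ ∈ N) (x : H1 χ N) : conj χ N σ x = x := by
  obtain ⟨f, rfl⟩ := H1.mk_surjective χ N x
  -- Expanding `f (σ⁻¹ h σ)` by the cocycle relation gives `σ • f (σ⁻¹ h σ) = f h + h • f σ - f σ`,
  -- so the difference is the coboundary of `-f σ`.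
  refine H1.mk_eq_mk.2 ⟨-f.1 ⟨σ, hσ⟩, fun h => ?_⟩
  change f.1 h - (χ σ : A) * f.1 (MulAut.conjNormal σ⁻¹ h) = _
  have h1 : (MulAut.conjNormal σ⁻¹ h : N) = (⟨σ, hσ⟩ : N)⁻¹ * (h * ⟨σ, hσ⟩) := by
    apply Subtype.ext
    simp [mul_assoc]
  rw [h1, f.2.2, f.2.2, Z1_map_inv f, Subgroup.coe_inv, map_inv]
  have h2 : (χ σ : A) * ((χ σ)⁻¹ : Aˣ) = 1 := by simp
  linear_combination (f.1 ⟨σ, hσ⟩ - (f.1 h + χ h * f.1 ⟨σ, hσ⟩)) * h2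

/-- The corestriction may be computed by means of any system of coset representatives. -/
theorem cor_mk_eq [IsTopologicalGroup Γ] (χ : Γ →* Aˣ) (U H : Subgroup Γ)
    (hU : IsOpen (U : Set Γ)) [Finite (H ⧸ U.subgroupOf H)] (f : Z1 χ U) (g : Z1 χ H)
    {ι : Type*} [Fintype ι] (t : ι → H) (π : H → ι → ι) (c : H → ι → U)
    (htc : ∀ (h : H) (i : ι), (h : Γ) * t i = t (π h i) * c h i)
    (ht : Function.Bijective fun i => (t i : H ⧸ U.subgroupOf H))
    (hg : ∀ h, g.1 h = ∑ i, (χ (t (π h i)) : A) * f.1 (c h i)) :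
    cor χ U H hU (H1.mk χ U f) = H1.mk χ H g := by
  have := Fintype.ofFinite (H ⧸ U.subgroupOf H)
  let e : ι ≃ H ⧸ U.subgroupOf H := Equiv.ofBijective _ ht
  have he (i : ι) : e i = (t i : H ⧸ U.subgroupOf H) := rfl
  have hu (i : ι) : ((e i).out⁻¹ * t i : Γ) ∈ U := by
    have : ((e i).out : H)⁻¹ * t i ∈ U.subgroupOf H := by
      rw [← QuotientGroup.eq, QuotientGroup.out_eq', he]
    exact this
  let u : ι → U := fun i => ⟨_, hu i⟩
  have htu (i : ι) : (t i : Γ) = ((e i).out : H) * u i := by simp [u]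
  have hπ (h : H) (i : ι) : h • e i = e (π h i) := by
    rw [he, he, MulAction.Quotient.smul_coe, smul_eq_mul, QuotientGroup.eq,
      Subgroup.mem_subgroupOf]
    have : (((h * t i)⁻¹ * t (π h i) : H) : Γ) = (c h i : Γ)⁻¹ := by
      have := htc h i
      push_cast
      rw [this]
      group
    rw [this]
    exact inv_mem (c h i).2
  have hshift (h : H) (i : ι) : cosetShift U H h (e i) = u (π h i) * (c h i * (u i)⁻¹) := by
    apply Subtype.ext
    have h1 := coe_cosetShift U H h (e i)
    rw [hπ] at h1
    refine mul_left_cancel (a := (((e (π h i)).out : H) : Γ)) (h1.trans ?_)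
    push_cast
    rw [← mul_assoc, ← htu, ← mul_assoc, ← htc, htu]
    group
  have hχ (h : H) (i : ι) : (χ (t (π h i)) : A) * χ (c h i) = χ h * χ (t i) := by
    rw [← Units.val_mul, ← Units.val_mul, ← map_mul, ← map_mul, htc]
  have hχt (i : ι) : (χ (t i) : A) = χ ((e i).out : H) * χ (u i) := by
    rw [← Units.val_mul, ← map_mul, htu]
  -- With `t i = s i * u i`, where `s i` is the standard representative and `u i ∈ U`, the two
  -- cocycles differ by the coboundary of `∑ s i • f (u i)`.
  refine H1.mk_eq_mk.2 ⟨∑ i, (χ ((e i).out : H) : A) * f.1 (u i), fun h => ?_⟩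
  change g.1 h - ∑ᶠ q : H ⧸ U.subgroupOf H, (χ ((h • q).out : H) : A) * f.1 (cosetShift U H h q) = _
  rw [finsum_eq_sum_of_fintype, ← e.sum_comp]
  have hperm : Function.Bijective (π h) := by
    have : π h = e.symm ∘ (fun q => h • q) ∘ e := by
      funext i
      simp [hπ]
    rw [this]
    exact e.symm.bijective.comp ((MulAction.bijective h).comp e.bijective)
  have h3 : ∑ i, (χ ((e i).out : H) : A) * f.1 (u i) =
      ∑ i, (χ ((e (π h i)).out : H) : A) * f.1 (u (π h i)) :=
    ((Equiv.ofBijective _ hperm).sum_comp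
      fun i => (χ ((e i).out : H) : A) * f.1 (u i)).symm
  conv_rhs => rw [Finset.mul_sum, h3]
  rw [hg, ← Finset.sum_sub_distrib, ← Finset.sum_sub_distrib]
  refine Finset.sum_congr rfl fun i _ => ?_
  rw [hshift, hπ, f.2.2, f.2.2, Z1_map_inv f]
  have h4 : (χ (u i) : A) * ((χ (u i))⁻¹ : Aˣ) = 1 := by simp
  have h5 := hχ h i
  have h6 := hχt i
  have h7 := hχt (π h i)
  rw [h7] at h5 ⊢
  rw [h6] at h5
  linear_combination (((χ (u i))⁻¹ : Aˣ) : A) * f.1 (u i) * h5 +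
    (χ h : A) * (χ ((e i).out : H) : A) * f.1 (u i) * h4

/-- The action by conjugation commutes with the corestriction. -/
theorem conj_cor [IsTopologicalGroup Γ] (χ : Γ →* Aˣ) (U H : Subgroup Γ) [U.Normal] [H.Normal]
    (hU : IsOpen (U : Set Γ)) [Finite (H ⧸ U.subgroupOf H)] (σ : Γ) (x : H1 χ U) :
    conj χ H σ (cor χ U H hU x) = cor χ U H hU (conj χ U σ x) := by
  obtain ⟨f, rfl⟩ := H1.mk_surjective χ U x
  have := Fintype.ofFinite (H ⧸ U.subgroupOf H)
  symm
  -- With the conjugates `σ s σ⁻¹` as representatives, the equality already holds for cocycles; `h`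
  -- permutes the cosets through `σ⁻¹ h σ`.
  refine cor_mk_eq χ U H hU (conjZ1 χ U σ f) (conjZ1 χ H σ (corZ1 χ U H hU f))
    (ι := H ⧸ U.subgroupOf H) (fun q => MulAut.conjNormal σ q.out)
    (fun h q => (MulAut.conjNormal σ⁻¹ h : H) • q)
    (fun h q => MulAut.conjNormal σ (cosetShift U H (MulAut.conjNormal σ⁻¹ h) q)) ?_ ?_ ?_
  · intro h q
    have := coe_cosetShift U H (MulAut.conjNormal σ⁻¹ h) q
    simp only [MulAut.conjNormal_apply] at this ⊢
    rw [conj_mul, this]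
    group
  · have hn : (U.subgroupOf H).map (MulAut.conjNormal σ : MulAut H).toMonoidHom =
        U.subgroupOf H := by
      apply le_antisymm
      · rintro _ ⟨y, hy, rfl⟩
        have : σ * (y : Γ) * σ⁻¹ ∈ U := ‹U.Normal›.conj_mem _ (Subgroup.mem_subgroupOf.1 hy) σ
        simpa [Subgroup.mem_subgroupOf] using this
      · intro y hy
        refine ⟨MulAut.conjNormal σ⁻¹ y, ?_, by ext; simp⟩
        have : σ⁻¹ * (y : Γ) * σ⁻¹⁻¹ ∈ U := ‹U.Normal›.conj_mem _ (Subgroup.mem_subgroupOf.1 hy) σ⁻¹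
        simpa [Subgroup.mem_subgroupOf] using this
    have hb : (fun q : H ⧸ U.subgroupOf H =>
        ((MulAut.conjNormal σ q.out : H) : H ⧸ U.subgroupOf H)) =
        QuotientGroup.congr _ _ (MulAut.conjNormal σ : MulAut H) hn := by
      funext q
      conv_rhs => rw [← QuotientGroup.out_eq' q]
      rfl
    rw [hb]
    exact MulEquiv.bijective _
  · intro h
    change (χ σ : A) * ∑ᶠ q : H ⧸ U.subgroupOf H, _ = _
    rw [finsum_eq_sum_of_fintype, Finset.mul_sum]
    refine Finset.sum_congr rfl fun q _ => ?_
    change _ = (χ _ : A) * ((χ σ : A) * f.1 _)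
    have h1 : (MulAut.conjNormal σ⁻¹ (MulAut.conjNormal σ
        (cosetShift U H (MulAut.conjNormal σ⁻¹ h) q)) : U) =
        cosetShift U H (MulAut.conjNormal σ⁻¹ h) q := by
      ext
      simp
    have h2 (y : H) : (χ (MulAut.conjNormal σ y : H) : A) = χ y := by simp
    rw [h1, h2]
    ring

/-- Transitivity of the corestriction. -/
theorem cor_cor [IsTopologicalGroup Γ] (χ : Γ →* Aˣ) (U V H : Subgroup Γ) (hUV : U ≤ V)
    (hVH : V ≤ H) (hU : IsOpen (U : Set Γ)) (hV : IsOpen (V : Set Γ))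
    [Finite (H ⧸ U.subgroupOf H)] [Finite (H ⧸ V.subgroupOf H)] [Finite (V ⧸ U.subgroupOf V)]
    (x : H1 χ U) : cor χ V H hV (cor χ U V hU x) = cor χ U H hU x := by
  obtain ⟨f, rfl⟩ := H1.mk_surjective χ U x
  have := Fintype.ofFinite (H ⧸ V.subgroupOf H)
  have := Fintype.ofFinite (V ⧸ U.subgroupOf V)
  symm
  -- Products of representatives for `H/V` and `V/U` represent `H/U`, and with this choice the
  -- double sum is the iterated corestriction cocycle itself.
  refine cor_mk_eq χ U H hU f (corZ1 χ V H hV (corZ1 χ U V hU f))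
    (ι := (H ⧸ V.subgroupOf H) × (V ⧸ U.subgroupOf V))
    (fun i => i.1.out * Subgroup.inclusion hVH i.2.out)
    (fun h i => (h • i.1, cosetShift V H h i.1 • i.2))
    (fun h i => cosetShift U V (cosetShift V H h i.1) i.2) ?_ ⟨?_, ?_⟩ ?_
  · rintro h ⟨q, q'⟩
    have h1 := coe_cosetShift V H h q
    have h2 := coe_cosetShift U V (cosetShift V H h q) q'
    push_cast
    rw [mul_assoc, Subgroup.coe_inclusion, Subgroup.coe_inclusion, h2, ← mul_assoc, ← mul_assoc, h1]
  · rintro ⟨q₁, q₁'⟩ ⟨q₂, q₂'⟩ h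
    have h1 := QuotientGroup.eq.1 h
    have h2 : (q₁.out : H ⧸ V.subgroupOf H) = q₂.out := by
      rw [QuotientGroup.eq, Subgroup.mem_subgroupOf]
      have h3 := mul_mem (mul_mem q₁'.out.2 (hUV (Subgroup.mem_subgroupOf.1 h1)))
        (inv_mem q₂'.out.2)
      convert h3 using 1
      push_cast
      simp only [Subgroup.coe_inclusion]
      group
    rw [QuotientGroup.out_eq', QuotientGroup.out_eq'] at h2
    subst h2
    have h4 : (q₁'.out : V ⧸ U.subgroupOf V) = q₂'.out := by
      rw [QuotientGroup.eq, Subgroup.mem_subgroupOf]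
      convert Subgroup.mem_subgroupOf.1 h1 using 1
      push_cast
      simp only [Subgroup.coe_inclusion]
      group
    rw [QuotientGroup.out_eq', QuotientGroup.out_eq'] at h4
    rw [h4]
  · intro q
    have hv : (((q.out : H ⧸ V.subgroupOf H).out : H)⁻¹ * q.out : Γ) ∈ V := by
      have : ((q.out : H ⧸ V.subgroupOf H).out : H)⁻¹ * q.out ∈ V.subgroupOf H := by
        rw [← QuotientGroup.eq, QuotientGroup.out_eq']
      exact this
    have hw : (((((⟨_, hv⟩ : V) : V ⧸ U.subgroupOf V).out : V) : Γ)⁻¹ *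
        (((q.out : H ⧸ V.subgroupOf H).out : H)⁻¹ * q.out : Γ)) ∈ U := by
      have : ((((⟨_, hv⟩ : V) : V ⧸ U.subgroupOf V).out : V))⁻¹ * ⟨_, hv⟩ ∈ U.subgroupOf V := by
        rw [← QuotientGroup.eq, QuotientGroup.out_eq']
      exact this
    refine ⟨((q.out : H ⧸ V.subgroupOf H), ((⟨_, hv⟩ : V) : V ⧸ U.subgroupOf V)), ?_⟩
    conv_rhs => rw [← QuotientGroup.out_eq' q]
    refine QuotientGroup.eq.2 (Subgroup.mem_subgroupOf.2 ?_)
    convert hw using 1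
    push_cast
    simp only [Subgroup.coe_inclusion]
    group
  · intro h
    change ∑ᶠ q : H ⧸ V.subgroupOf H, (χ (h • q).out : A) * ∑ᶠ q' : V ⧸ U.subgroupOf V, _ = _
    simp only [finsum_eq_sum_of_fintype, Finset.mul_sum]
    rw [Fintype.sum_prod_type]
    refine Finset.sum_congr rfl fun q _ => Finset.sum_congr rfl fun q' _ => ?_
    simp [mul_assoc]

theorem coeffMap_cor [IsTopologicalGroup Γ] {B : Type*} [CommRing B] (χ : Γ →* Aˣ) (ψ : Γ →* Bˣ)
    (φ : A →+* B) (hφ : ∀ g, φ (χ g) = ψ g) (U H : Subgroup Γ)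
    (hU : IsOpen (U : Set Γ)) [Finite (H ⧸ U.subgroupOf H)] (x : H1 χ U) :
    coeffMap χ ψ φ hφ H (cor χ U H hU x) = cor ψ U H hU (coeffMap χ ψ φ hφ U x) := by
  obtain ⟨f, rfl⟩ := H1.mk_surjective χ U x
  refine congrArg (H1.mk ψ H) (Subtype.ext (funext fun h => ?_))
  have := Fintype.ofFinite (H ⧸ U.subgroupOf H)
  change φ (∑ᶠ q : H ⧸ U.subgroupOf H, (χ ((h • q).out : H) : A) * f.1 (cosetShift U H h q)) =
    ∑ᶠ q : H ⧸ U.subgroupOf H, (ψ ((h • q).out : H) : B) * φ (f.1 (cosetShift U H h q))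
  simp only [finsum_eq_sum_of_fintype, map_sum, map_mul, hφ]

theorem coeffMap_conj [IsTopologicalGroup Γ] {B : Type*} [CommRing B] (χ : Γ →* Aˣ) (ψ : Γ →* Bˣ)
    (φ : A →+* B) (hφ : ∀ g, φ (χ g) = ψ g) (N : Subgroup Γ) [N.Normal] (σ : Γ) (x : H1 χ N) :
    coeffMap χ ψ φ hφ N (conj χ N σ x) = conj ψ N σ (coeffMap χ ψ φ hφ N x) := by
  obtain ⟨f, rfl⟩ := H1.mk_surjective χ N x
  refine congrArg (H1.mk ψ N) (Subtype.ext (funext fun h => ?_))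
  change φ ((χ σ : A) * f.1 (MulAut.conjNormal σ⁻¹ h)) =
    (ψ σ : B) * φ (f.1 (MulAut.conjNormal σ⁻¹ h))
  rw [map_mul, hφ]

end

end ContH1

/-! ### Galois theory inside `Qbar` -/

namespace CycloElt

theorem normal_iff_map_mem (K : IntermediateField ℚ Qbar) :
    Normal ℚ K ↔ ∀ (σ : Gal(Qbar/ℚ)) (x : Qbar), x ∈ K → σ x ∈ K := by
  -- `K` carries two `ℚ`-algebra instances, which agree because such a structure is unique.
  have e : (DivisionRing.toRatAlgebra : Algebra ℚ K) = K.algebra' := Subsingleton.elim _ _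
  rw [e, IntermediateField.normal_iff_forall_map_le']
  exact forall_congr' fun σ =>
    ⟨fun h x hx => h ⟨x, hx, rfl⟩, by rintro h _ ⟨x, hx, rfl⟩; exact h x hx⟩

theorem map_mem {K : IntermediateField ℚ Qbar} [hK : Normal ℚ K] (σ : Gal(Qbar/ℚ)) {x : Qbar}
    (hx : x ∈ K) : σ x ∈ K :=
  (normal_iff_map_mem K).1 hK σ x hx

theorem mem_fixingSubgroup {K : IntermediateField ℚ Qbar} {σ : Gal(Qbar/ℚ)} :
    σ ∈ K.fixingSubgroup ↔ ∀ x ∈ K, σ x = x :=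
  IntermediateField.mem_fixingSubgroup_iff K σ

instance (K : IntermediateField ℚ Qbar) [Normal ℚ K] : K.fixingSubgroup.Normal := by
  refine ⟨fun n hn σ => mem_fixingSubgroup.2 fun x hx => ?_⟩
  have h := mem_fixingSubgroup.1 hn _ (map_mem σ⁻¹ hx)
  change σ (n (σ⁻¹ x)) = x
  rw [h]
  exact σ.apply_symm_apply x

instance (F K : IntermediateField ℚ Qbar) [hF : Normal ℚ F] [hK : Normal ℚ K] :
    Normal ℚ (F ⊔ K : IntermediateField ℚ Qbar) := by
  rw [normal_iff_map_mem] at hF hK ⊢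
  intro σ x hx
  have : F ⊔ K ≤ (F ⊔ K).comap (σ : Qbar →ₐ[ℚ] Qbar) := sup_le
    (fun y hy => (le_sup_left : F ≤ F ⊔ K) (hF σ y hy))
    (fun y hy => (le_sup_right : K ≤ F ⊔ K) (hK σ y hy))
  exact this hx

theorem mem_of_forall_fixingSubgroup {K : IntermediateField ℚ Qbar} {x : Qbar}
    (h : ∀ σ ∈ K.fixingSubgroup, σ x = x) : x ∈ K := by
  rw [← InfiniteGalois.fixedField_fixingSubgroup K]
  exact (IntermediateField.mem_fixedField_iff _ _).2 h

/-- For a finite normal extension `A`, an automorphism over `A ∩ B` is a product of automorphisms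
over `A` and over `B`. -/
theorem exists_mul_of_mem_fixingSubgroup_inf (A B : IntermediateField ℚ Qbar)
    [FiniteDimensional ℚ A] [Normal ℚ A] {σ : Gal(Qbar/ℚ)} (hσ : σ ∈ (A ⊓ B).fixingSubgroup) :
    ∃ α ∈ A.fixingSubgroup, ∃ β ∈ B.fixingSubgroup, α * β = σ := by
  -- As `A` is finite over `ℚ`, the join contains an open subgroup. It is therefore open, hence
  -- closed, and the Galois correspondence recovers it from its fixed field, which lies in `A ∩ B`.
  have ho : IsOpen ((A.fixingSubgroup ⊔ B.fixingSubgroup : Subgroup Gal(Qbar/ℚ)) : Set Gal(Qbar/ℚ)) :=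
    Subgroup.isOpen_mono le_sup_left A.fixingSubgroup_isOpen
  let C : ClosedSubgroup Gal(Qbar/ℚ) :=
    ⟨A.fixingSubgroup ⊔ B.fixingSubgroup, Subgroup.isClosed_of_isOpen _ ho⟩
  have h1 : IntermediateField.fixedField (C : Subgroup Gal(Qbar/ℚ)) ≤ A ⊓ B := by
    refine le_inf ?_ ?_ <;> intro x hx <;> refine mem_of_forall_fixingSubgroup fun σ hσ => ?_
    · exact (IntermediateField.mem_fixedField_iff _ _).1 hx σ
        ((le_sup_left : _ ≤ A.fixingSubgroup ⊔ B.fixingSubgroup) hσ)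
    · exact (IntermediateField.mem_fixedField_iff _ _).1 hx σ
        ((le_sup_right : _ ≤ A.fixingSubgroup ⊔ B.fixingSubgroup) hσ)
  have h2 := IntermediateField.fixingSubgroup_antitone h1 hσ
  rw [InfiniteGalois.fixingSubgroup_fixedField] at h2
  -- Normality of `A` makes the join a set of products.
  exact Subgroup.mem_sup_of_normal_left.1 h2

/-! ### Systems of coset representatives and norms -/

/-- `s` is a system of representatives of the cosets `v U`, for `v ∈ V`. -/
structure IsTransversal {G ι : Type*} [Group G] (V U : Subgroup G) (s : ι → G) : Prop where
  mem : ∀ i, s i ∈ V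
  exists_mem : ∀ v ∈ V, ∃ i, (s i)⁻¹ * v ∈ U
  inj : ∀ i j, (s i)⁻¹ * s j ∈ U → i = j

theorem IsTransversal.mul {G ι κ : Type*} [Group G] {W V U : Subgroup G} {s : ι → G} {t : κ → G}
    (hs : IsTransversal W V s) (ht : IsTransversal V U t) (hUV : U ≤ V) (hVW : V ≤ W) :
    IsTransversal W U (fun i : ι × κ => s i.1 * t i.2) where
  mem i := mul_mem (hs.mem _) (hVW (ht.mem _))
  exists_mem w hw := by
    obtain ⟨i, hi⟩ := hs.exists_mem w hw
    obtain ⟨j, hj⟩ := ht.exists_mem _ hi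
    exact ⟨(i, j), by simpa [mul_assoc] using hj⟩
  inj := by
    rintro ⟨i, j⟩ ⟨i', j'⟩ h
    have h1 : i = i' := hs.inj _ _ (by
      have := mul_mem (mul_mem (ht.mem j) (hUV h)) (inv_mem (ht.mem j'))
      convert this using 1
      group)
    subst h1
    have h2 : j = j' := ht.inj _ _ (by
      convert h using 1
      group)
    rw [h2]

theorem isTransversal_out {G : Type*} [Group G] (V U : Subgroup G) :
    IsTransversal V U (fun q : V ⧸ U.subgroupOf V => (q.out : G)) where
  mem q := q.out.2
  exists_mem v hv := ⟨((⟨v, hv⟩ : V) : V ⧸ U.subgroupOf V), by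
    have := QuotientGroup.eq.1 (QuotientGroup.out_eq' ((⟨v, hv⟩ : V) : V ⧸ U.subgroupOf V))
    exact this⟩
  inj q q' h := by
    rw [← QuotientGroup.out_eq' q, ← QuotientGroup.out_eq' q', QuotientGroup.eq]
    exact h

/-- The image of a system of representatives for `V'/U'` in a quotient, for which
`V = (V ∩ V') U`. -/
theorem IsTransversal.change {G ι : Type*} [Group G] {V U V' U' : Subgroup G} {s : ι → G}
    (hs : IsTransversal V U s) (hV : V ≤ V') (h : ∀ v ∈ V', ∃ w ∈ V, w⁻¹ * v ∈ U')
    (hU : U ≤ U') (hU' : ∀ v ∈ V, v ∈ U' → v ∈ U) : IsTransversal V' U' s where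
  mem i := hV (hs.mem i)
  exists_mem v hv := by
    obtain ⟨w, hw, hwv⟩ := h v hv
    obtain ⟨i, hi⟩ := hs.exists_mem w hw
    exact ⟨i, by simpa [mul_assoc] using mul_mem (hU hi) hwv⟩
  inj i j hij := hs.inj i j (hU' _ (mul_mem (inv_mem (hs.mem i)) (hs.mem j)) hij)

instance {K L : IntermediateField ℚ Qbar} (h : K ≤ L) [hL : FiniteDimensional ℚ L] :
    FiniteDimensional K (IntermediateField.extendScalars h) := by
  have : FiniteDimensional ℚ (IntermediateField.extendScalars h) := hL
  have : IsScalarTower ℚ K (IntermediateField.extendScalars h) := inferInstance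
  exact FiniteDimensional.right ℚ K (IntermediateField.extendScalars h)

/-- The embedding over `K` of an extension `L` of `K` given by an automorphism over `K`. -/
noncomputable def embedding {K L : IntermediateField ℚ Qbar} (h : K ≤ L) (σ : Gal(Qbar/ℚ))
    (hσ : σ ∈ K.fixingSubgroup) : IntermediateField.extendScalars h →ₐ[K] Qbar :=
  { (σ : Qbar →+* Qbar).comp (algebraMap (IntermediateField.extendScalars h) Qbar) with
    commutes' := fun x => mem_fixingSubgroup.1 hσ x x.2 }

/-- `Qbar` is normal over `K`, so an embedding of `L` lifts to an endomorphism of `Qbar` over `K`,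
which is automatically bijective. -/
theorem embedding_surjective {K L : IntermediateField ℚ Qbar} (h : K ≤ L)
    (f : IntermediateField.extendScalars h →ₐ[K] Qbar) :
    ∃ (σ : Gal(Qbar/ℚ)) (hσ : σ ∈ K.fixingSubgroup), embedding h σ hσ = f := by
  have : Normal K Qbar := normal_iff.2 fun x =>
    ⟨Algebra.IsIntegral.isIntegral x, IsAlgClosed.splits _⟩
  let T : Qbar →ₐ[K] Qbar := f.liftNormal Qbar
  have hT (x : L) : T x = f x := f.liftNormal_commutes Qbar x
  let σ : Gal(Qbar/ℚ) := 
    (AlgEquiv.ofBijective T (AlgHom.normal_bijective K Qbar Qbar T)).restrictScalars ℚ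
  refine ⟨σ, mem_fixingSubgroup.2 fun x hx => T.commutes ⟨x, hx⟩, AlgHom.ext fun x => hT x⟩

/-- The norm as a product over a system of representatives of `Gal(Qbar/K)/Gal(Qbar/L)`. -/
theorem fieldNorm_eq_prod {K L : IntermediateField ℚ Qbar} (h : K ≤ L) [FiniteDimensional ℚ L]
    {ι : Type*} [Fintype ι] {s : ι → Gal(Qbar/ℚ)}
    (hs : IsTransversal K.fixingSubgroup L.fixingSubgroup s) (x : L) :
    (fieldNorm h x : Qbar) = ∏ i, s i x := by
  have h1 := Algebra.norm_eq_prod_embeddings K Qbar (L := IntermediateField.extendScalars h) x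
  refine h1.trans (Fintype.prod_bijective (fun i => embedding h (s i) (hs.mem i)) ⟨?_, ?_⟩ _ _ ?_).symm
  · intro i j hij
    refine hs.inj i j (mem_fixingSubgroup.2 fun y hy => ?_)
    have h2 : s i y = s j y := DFunLike.congr_fun hij (⟨y, hy⟩ : L)
    change (s i).symm (s j y) = y
    rw [← h2, AlgEquiv.symm_apply_apply]
  · intro f
    obtain ⟨σ, hσ, rfl⟩ := embedding_surjective h f
    obtain ⟨i, hi⟩ := hs.exists_mem σ hσ
    refine ⟨i, ?_⟩
    refine AlgHom.ext fun y => ?_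
    have h2 := mem_fixingSubgroup.1 hi y y.2
    change (s i).symm (σ y) = y at h2
    change s i y = σ y
    have h3 := congrArg (s i) h2
    rw [AlgEquiv.apply_symm_apply] at h3
    exact h3.symm
  · intro i
    rfl

end CycloElt

/-! ### Transitivity and base change of norms -/

namespace CycloElt

instance {K : IntermediateField ℚ Qbar} (H : Subgroup Gal(Qbar/ℚ)) [FiniteDimensional ℚ K] :
    Finite (H ⧸ K.fixingSubgroup.subgroupOf H) := by
  have h : IsOpen (K.fixingSubgroup : Set Gal(Qbar/ℚ)) := K.fixingSubgroup_isOpen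
  have := Subgroup.quotient_finite_of_isOpen _ h
  have : K.fixingSubgroup.FiniteIndex := Subgroup.finiteIndex_of_finite_quotient
  infer_instance

/-- Transitivity of the norm. -/
theorem fieldNorm_fieldNorm {K L M : IntermediateField ℚ Qbar} (h : K ≤ L) (h' : L ≤ M)
    [FiniteDimensional ℚ L] [FiniteDimensional ℚ M] (x : M) :
    fieldNorm h (fieldNorm h' x) = fieldNorm (h.trans h') x := by
  have := Fintype.ofFinite (K.fixingSubgroup ⧸ L.fixingSubgroup.subgroupOf K.fixingSubgroup)
  have := Fintype.ofFinite (L.fixingSubgroup ⧸ M.fixingSubgroup.subgroupOf L.fixingSubgroup)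
  have hs := isTransversal_out K.fixingSubgroup L.fixingSubgroup
  have ht := isTransversal_out L.fixingSubgroup M.fixingSubgroup
  apply Subtype.ext
  rw [fieldNorm_eq_prod h hs, fieldNorm_eq_prod h' ht, fieldNorm_eq_prod _
    (hs.mul ht (IntermediateField.fixingSubgroup_antitone h')
      (IntermediateField.fixingSubgroup_antitone h)), Fintype.prod_prod_type]
  refine Finset.prod_congr rfl fun q _ => ?_
  rw [map_prod]
  rfl

/-- Compatibility of norms with base change: if `L = K L'` and `K' = K ∩ L'`, then the norm
`L → K` induces on `L'` the norm `L' → K'`. -/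
theorem fieldNorm_eq_of_inf {K L K' L' : IntermediateField ℚ Qbar} (h : K ≤ L) (h' : K' ≤ L')
    [FiniteDimensional ℚ K] [FiniteDimensional ℚ L] [FiniteDimensional ℚ L'] [Normal ℚ K]
    (hL : L ≤ K ⊔ L') (hLL : L' ≤ L) (hKK : K' ≤ K) (hK : K ⊓ L' ≤ K') (x : L) (y : L')
    (hxy : (x : Qbar) = y) :
    (fieldNorm h x : Qbar) = fieldNorm h' y := by
  have := Fintype.ofFinite (K.fixingSubgroup ⧸ L.fixingSubgroup.subgroupOf K.fixingSubgroup)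
  have hs := isTransversal_out K.fixingSubgroup L.fixingSubgroup
  -- Representatives for `L/K` also serve for `L'/K'`: every automorphism over `K ∩ L'` is one over
  -- `K` times one over `L'`, and fixing both `K` and `L'` means fixing `L`.
  have hs' : IsTransversal K'.fixingSubgroup L'.fixingSubgroup _ :=
    hs.change (IntermediateField.fixingSubgroup_antitone hKK) (fun v hv => by
      obtain ⟨α, hα, β, hβ, rfl⟩ := exists_mul_of_mem_fixingSubgroup_inf K L'
        (IntermediateField.fixingSubgroup_antitone hK hv)
      exact ⟨α, hα, by simpa using hβ⟩) (IntermediateField.fixingSubgroup_antitone hLL)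
      (fun v hv hv' => by
        refine IntermediateField.fixingSubgroup_antitone hL ?_
        rw [IntermediateField.fixingSubgroup_sup]
        exact ⟨hv, hv'⟩)
  rw [fieldNorm_eq_prod h hs, fieldNorm_eq_prod h' hs', hxy]

/-! ### Cyclotomic fields -/

theorem zeta_pow_of_dvd {M N : ℕ} [NeZero M] [NeZero N] (h : M ∣ N) :
    zeta N ^ (N / M) = zeta M := by
  obtain ⟨k, rfl⟩ := h
  have : NeZero k := ⟨right_ne_zero_of_mul (NeZero.ne (M * k))⟩
  rw [Nat.mul_div_cancel_left _ (NeZero.pos M), ← zeta_mul_pow k M]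
  congr 2
  exact mul_comm _ _

theorem cyc_le_of_dvd {M N : ℕ} [NeZero M] [NeZero N] (h : M ∣ N) : cyc M ≤ cyc N := by
  refine IntermediateField.adjoin_simple_le_iff.2 ?_
  rw [← zeta_pow_of_dvd h]
  exact pow_mem (zeta_mem_cyc N) _

theorem mem_fixingSubgroup_cyc {N : ℕ} [NeZero N] {σ : Gal(Qbar/ℚ)} :
    σ ∈ (cyc N).fixingSubgroup ↔ σ (zeta N) = zeta N := by
  refine ⟨fun h => mem_fixingSubgroup.1 h _ (zeta_mem_cyc N), fun h => ?_⟩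
  have : cyc N ≤ IntermediateField.fixedField (Subgroup.zpowers σ) := by
    refine IntermediateField.adjoin_simple_le_iff.2 ?_
    refine (IntermediateField.mem_fixedField_iff _ _).2 fun τ hτ => ?_
    have h2 : Subgroup.zpowers σ ≤ MulAction.stabilizer Gal(Qbar/ℚ) (zeta N) :=
      Subgroup.zpowers_le.2 h
    exact h2 hτ
  exact mem_fixingSubgroup.2 fun x hx =>
    (IntermediateField.mem_fixedField_iff _ _).1 (this hx) σ (Subgroup.mem_zpowers σ)

theorem exists_pow_zeta (N : ℕ) [NeZero N] (σ : Gal(Qbar/ℚ)) :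
    ∃ k : ℕ, k.Coprime N ∧ σ (zeta N) = zeta N ^ k := by
  have h := (zeta_primitive N).map_of_injective σ.injective
  obtain ⟨k, -, hk, h'⟩ := ((zeta_primitive N).isPrimitiveRoot_iff).1 h
  exact ⟨k, hk, h'.symm⟩

instance (N : ℕ) [NeZero N] : Normal ℚ (cyc N) := by
  rw [normal_iff_map_mem]
  intro σ x hx
  have : cyc N ≤ (cyc N).comap (σ : Qbar →ₐ[ℚ] Qbar) := by
    refine IntermediateField.adjoin_simple_le_iff.2 ?_
    obtain ⟨k, -, hk⟩ := exists_pow_zeta N σ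
    change σ (zeta N) ∈ cyc N
    rw [hk]
    exact pow_mem (zeta_mem_cyc N) k
  exact this hx

instance (F : IntermediateField ℚ Qbar) [Normal ℚ F] (p : ℕ) [Fact p.Prime] (n : ℕ) :
    Normal ℚ (layer F p n) :=
  inferInstanceAs (Normal ℚ (F ⊔ cyc (p ^ n) : IntermediateField ℚ Qbar))

/-- Irreducibility of the cyclotomic polynomial over `ℚ` makes all primitive `N`-th roots of unity
conjugate. -/
theorem exists_aut_pow (N : ℕ) [NeZero N] {k : ℕ} (hk : k.Coprime N) :
    ∃ σ : Gal(Qbar/ℚ), σ (zeta N) = zeta N ^ k := by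
  have h : IsConjRoot ℚ (zeta N ^ k) (zeta N) := by
    change minpoly _ _ = minpoly _ _
    rw [← Polynomial.cyclotomic_eq_minpoly_rat (zeta_primitive N) (NeZero.pos N),
      ← Polynomial.cyclotomic_eq_minpoly_rat ((zeta_primitive N).pow_of_coprime k hk) (NeZero.pos N)]
  obtain ⟨σ, hσ⟩ := IsConjRoot.exists_algEquiv h
  exact ⟨σ, hσ⟩

theorem zeta_pow_eq_iff {M k k' : ℕ} [NeZero M] :
    zeta M ^ k = zeta M ^ k' ↔ k ≡ k' [MOD M] := by
  let z : Qbarˣ := Units.mk0 (zeta M) ((zeta_primitive M).ne_zero (NeZero.ne M))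
  have hz : orderOf z = M := by
    rw [← orderOf_units, Units.val_mk0, ← (zeta_primitive M).eq_orderOf]
  conv_rhs => rw [← hz]
  rw [← pow_eq_pow_iff_modEq]
  simp [Units.ext_iff, z]

theorem map_zeta_of_dvd {M N k : ℕ} [NeZero M] [NeZero N] (h : M ∣ N) {σ : Gal(Qbar/ℚ)}
    (hσ : σ (zeta N) = zeta N ^ k) : σ (zeta M) = zeta M ^ k := by
  rw [← zeta_pow_of_dvd h, map_pow, hσ, ← pow_mul, ← pow_mul, mul_comm]

/-- `ℚ(ζ_M) ∩ ℚ(ζ_N) = ℚ(ζ_{gcd(M, N)})`. -/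
theorem cyc_inf_cyc_le {M N g : ℕ} [NeZero M] [NeZero N] [NeZero g] (h : M.gcd N ∣ g) :
    cyc M ⊓ cyc N ≤ cyc g := by
  intro x hx
  refine mem_of_forall_fixingSubgroup fun σ hσ => ?_
  have : NeZero (M.lcm N) := ⟨Nat.lcm_ne_zero (NeZero.ne M) (NeZero.ne N)⟩
  have : NeZero (M.gcd N) := ⟨Nat.gcd_ne_zero_left (NeZero.ne M)⟩
  obtain ⟨u, hu, hσu⟩ := exists_pow_zeta (M.lcm N) σ
  have hσg := IntermediateField.fixingSubgroup_antitone (cyc_le_of_dvd h) hσ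
  rw [mem_fixingSubgroup_cyc,
    map_zeta_of_dvd ((Nat.gcd_dvd_left M N).trans (Nat.dvd_lcm_left M N)) hσu] at hσg
  have hug : 1 ≡ u [MOD M.gcd N] :=
    zeta_pow_eq_iff.1 (by rw [hσg, pow_one])
  -- `σ` acts by an exponent `u ≡ 1` modulo the gcd, so some `v` is `1` modulo `M` and `u` modulo
  -- `N`. The automorphism `τ` of exponent `v` fixes `ℚ(ζ_M)` and agrees with `σ` on `ℚ(ζ_N)`, so `σ
  -- x = τ x = x` on the intersection.
  obtain ⟨v, hvM, hvN⟩ := Nat.chineseRemainder' hug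
  have hv : v.Coprime (M.lcm N) := by
    refine Nat.Coprime.coprime_dvd_right (Nat.lcm_dvd_mul M N) (Nat.Coprime.mul_right ?_ ?_)
    · exact hvM.gcd_eq.trans (Nat.gcd_one_left M)
    · exact hvN.gcd_eq.trans (Nat.Coprime.coprime_dvd_right (Nat.dvd_lcm_right M N) hu)
  obtain ⟨τ, hτ⟩ := exists_aut_pow (M.lcm N) hv
  have h1 : τ ∈ (cyc M).fixingSubgroup := by
    rw [mem_fixingSubgroup_cyc, map_zeta_of_dvd (Nat.dvd_lcm_left M N) hτ,
      zeta_pow_eq_iff.2 hvM, pow_one]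
  have h2 : τ⁻¹ * σ ∈ (cyc N).fixingSubgroup := by
    rw [mem_fixingSubgroup_cyc, AlgEquiv.mul_apply, map_zeta_of_dvd (Nat.dvd_lcm_right M N) hσu,
      ← zeta_pow_eq_iff.2 hvN, ← map_zeta_of_dvd (Nat.dvd_lcm_right M N) hτ]
    exact τ.symm_apply_apply _
  have h3 := mem_fixingSubgroup.1 h2 x hx.2
  have h4 := congrArg τ h3
  rw [mem_fixingSubgroup.1 h1 x hx.1] at h4
  exact (τ.apply_symm_apply (σ x)).symm.trans h4

/-! ### Degrees of cyclotomic fields and norms of `1 - ζ` -/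

theorem finrank_cyc (N : ℕ) [NeZero N] : Module.finrank ℚ (cyc N) = N.totient := by
  have h := IntermediateField.adjoin.finrank
    (((zeta_primitive N).isIntegral (NeZero.pos N)).tower_top (A := ℚ))
  rw [← Polynomial.cyclotomic_eq_minpoly_rat (zeta_primitive N) (NeZero.pos N),
    Polynomial.natDegree_cyclotomic] at h
  exact h

theorem finrank_mul {K L : IntermediateField ℚ Qbar} (h : K ≤ L) :
    Module.finrank ℚ K * Module.finrank K (IntermediateField.extendScalars h) =
      Module.finrank ℚ L := by
  rw [← IntermediateField.relfinrank_eq_finrank_of_le h]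
  exact IntermediateField.finrank_bot_mul_relfinrank h

/-- The norm of `1 - ζ_M` to `ℚ(ζ_N)`, where `M = q N` with `q` prime, is the product of the
`1 - z`, for `z` in a set of the right cardinality containing the conjugates of `ζ_M`. -/
theorem fieldNorm_one_sub_zeta {M N : ℕ} [NeZero M] [NeZero N] (h : cyc N ≤ cyc M)
    (S : Finset Qbar) (hS : N.totient * S.card = M.totient)
    (hmem : ∀ σ ∈ (cyc N).fixingSubgroup, σ (zeta M) ∈ S) (x : cyc M)
    (hx : (x : Qbar) = 1 - zeta M) :
    (fieldNorm h x : Qbar) = ∏ z ∈ S, (1 - z) := by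
  classical
  have h1 := Algebra.norm_eq_prod_embeddings (cyc N) Qbar
    (L := IntermediateField.extendScalars h) x
  let φ : (IntermediateField.extendScalars h →ₐ[cyc N] Qbar) → Qbar :=
    fun f => f ⟨zeta M, zeta_mem_cyc M⟩
  have hφ (σ : Gal(Qbar/ℚ)) (hσ : σ ∈ (cyc N).fixingSubgroup) :
      φ (embedding h σ hσ) = σ (zeta M) := rfl
  have hinj : Function.Injective φ := by
    intro f g hfg
    obtain ⟨σ, hσ, rfl⟩ := embedding_surjective h f
    obtain ⟨τ, hτ, rfl⟩ := embedding_surjective h g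
    rw [hφ, hφ] at hfg
    have h2 : τ⁻¹ * σ ∈ (cyc M).fixingSubgroup := by
      rw [mem_fixingSubgroup_cyc, AlgEquiv.mul_apply, hfg]
      exact τ.symm_apply_apply _
    refine AlgHom.ext fun y => ?_
    have h3 := congrArg τ (mem_fixingSubgroup.1 h2 y y.2)
    exact (τ.apply_symm_apply _).symm.trans h3
  have hcard : Fintype.card (IntermediateField.extendScalars h →ₐ[cyc N] Qbar) = S.card := by
    rw [AlgHom.card]
    have h2 := finrank_mul h
    rw [finrank_cyc, finrank_cyc, ← hS] at h2
    exact Nat.eq_of_mul_eq_mul_left (Nat.totient_pos.2 (NeZero.pos N)) h2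
  -- The conjugates of `ζ_M` lie in `S`, are distinct, and number `φ(M)/φ(N) = #S`; so they exhaust
  -- `S`.
  have himage : Finset.univ.image φ = S := by
    refine Finset.eq_of_subset_of_card_le ?_ ?_
    · intro z hz
      obtain ⟨f, -, rfl⟩ := Finset.mem_image.1 hz
      obtain ⟨σ, hσ, rfl⟩ := embedding_surjective h f
      exact hmem σ hσ
    · rw [Finset.card_image_of_injective _ hinj, Finset.card_univ, hcard]
  refine h1.trans ?_
  rw [← himage, Finset.prod_image hinj.injOn]
  refine Finset.prod_congr rfl fun f _ => ?_
  have h2 : x = (1 - ⟨zeta M, zeta_mem_cyc M⟩ : IntermediateField.extendScalars h) :=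
    Subtype.ext hx
  rw [h2, map_sub, map_one]

/-- The set of the `q`-th roots of `w ^ q`. -/
noncomputable def rootSet (q : ℕ) {w : Qbar} (hw : w ≠ 0) : Finset Qbar :=
  (Polynomial.nthRootsFinset q (1 : Qbar)).map ⟨fun z => z * w, fun _ _ h => mul_right_cancel₀ hw h⟩

theorem mem_rootSet {q : ℕ} (hq : 0 < q) {w : Qbar} (hw : w ≠ 0) {x : Qbar} :
    x ∈ rootSet q hw ↔ x ^ q = w ^ q := by
  simp only [rootSet, Finset.mem_map, Polynomial.mem_nthRootsFinset hq]
  constructor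
  · rintro ⟨z, hz, rfl⟩
    exact (mul_pow z w q).trans (by rw [hz, one_mul])
  · intro h
    exact ⟨x / w, by rw [div_pow, h, div_self (pow_ne_zero _ hw)], div_mul_cancel₀ _ hw⟩

theorem card_rootSet {q : ℕ} [NeZero q] {w : Qbar} (hw : w ≠ 0) : (rootSet q hw).card = q :=
  (Finset.card_map _).trans (zeta_primitive q).card_nthRootsFinset

/-- This is `X^q - w^q = ∏ (X - ζ w)`, over the `q`-th roots of unity `ζ`, at `X = 1`. -/
theorem prod_rootSet {q : ℕ} [NeZero q] {w : Qbar} (hw : w ≠ 0) :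
    ∏ z ∈ rootSet q hw, (1 - z) = 1 - w ^ q := by
  rw [rootSet, Finset.prod_map]
  have := (zeta_primitive q).pow_sub_pow_eq_prod_sub_mul 1 w (NeZero.pos q)
  rw [one_pow] at this
  exact this.symm

theorem zeta_ne_zero (N : ℕ) [NeZero N] : zeta N ≠ 0 := (zeta_primitive N).ne_zero (NeZero.ne N)

theorem zeta_pow_prime {M N q : ℕ} [NeZero M] [NeZero N] (hM : M = q * N) :
    zeta M ^ q = zeta N := by
  subst hM
  have : NeZero q := ⟨left_ne_zero_of_mul (NeZero.ne (q * N))⟩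
  exact zeta_mul_pow q N

/-- The degree is `q` when `q ∣ N`, so the conjugates of `ζ_M` are all the `q`-th roots of `ζ_N`. -/
theorem fieldNorm_one_sub_zeta_of_dvd {M N q : ℕ} [NeZero M] [NeZero N] (hM : M = q * N)
    (hq : q.Prime) (hqN : q ∣ N) (h : cyc N ≤ cyc M) (x : cyc M) (hx : (x : Qbar) = 1 - zeta M) :
    (fieldNorm h x : Qbar) = 1 - zeta N := by
  have : NeZero q := ⟨hq.ne_zero⟩
  rw [fieldNorm_one_sub_zeta h (rootSet q (zeta_ne_zero M)) ?_ ?_ x hx, prod_rootSet (zeta_ne_zero M),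
    zeta_pow_prime hM]
  · rw [card_rootSet (zeta_ne_zero M), hM, Nat.totient_mul_of_prime_of_dvd hq hqN, mul_comm]
  · intro σ hσ
    rw [mem_rootSet hq.pos (zeta_ne_zero M), ← map_pow, zeta_pow_prime hM,
      mem_fixingSubgroup_cyc.1 hσ]

/-- The degree is now `q - 1`. Exactly one `q`-th root of `ζ_N` fails to be conjugate to `ζ_M`,
namely `τ⁻¹ ζ_N`, which is already an `N`-th root of unity; its factor is restored on the left-hand
side. -/
theorem fieldNorm_one_sub_zeta_of_not_dvd {M N q : ℕ} [NeZero M] [NeZero N] (hM : M = q * N)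
    (hq : q.Prime) (hqN : ¬ q ∣ N) (h : cyc N ≤ cyc M) (x : cyc M) (hx : (x : Qbar) = 1 - zeta M)
    (τ : Gal(Qbar/ℚ)) (hτ : τ (zeta N) = zeta N ^ q) :
    (fieldNorm h x : Qbar) * (1 - τ⁻¹ (zeta N)) = 1 - zeta N := by
  classical
  have : NeZero q := ⟨hq.ne_zero⟩
  set w := τ⁻¹ (zeta N) with hw
  have hwN : w ^ N = 1 := by rw [hw, ← map_pow, (zeta_primitive N).pow_eq_one, map_one]
  have hwq : w ^ q = zeta N := by
    rw [hw, ← map_pow, ← hτ]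
    exact τ.symm_apply_apply _
  have hmem : w ∈ rootSet q (zeta_ne_zero M) := by
    rw [mem_rootSet hq.pos (zeta_ne_zero M), hwq, zeta_pow_prime hM]
  rw [fieldNorm_one_sub_zeta h ((rootSet q (zeta_ne_zero M)).erase w) ?_ ?_ x hx,
    Finset.prod_erase_mul _ _ hmem, prod_rootSet (zeta_ne_zero M), zeta_pow_prime hM]
  · rw [Finset.card_erase_of_mem hmem, card_rootSet (zeta_ne_zero M), hM,
      Nat.totient_mul_of_prime_of_not_dvd hq hqN, mul_comm]
  · intro σ hσ
    rw [Finset.mem_erase]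
    refine ⟨fun h' => ?_, ?_⟩
    · have h1 : σ (zeta M) ^ N = 1 := by rw [h', hwN]
      rw [← map_pow, map_eq_one_iff _ σ.injective] at h1
      have h2 := Nat.le_of_dvd (NeZero.pos N) ((zeta_primitive M).dvd_of_pow_eq_one _ h1)
      have h3 := hq.two_le
      have h4 := NeZero.pos N
      nlinarith
    · rw [mem_rootSet hq.pos (zeta_ne_zero M), ← map_pow, zeta_pow_prime hM,
        mem_fixingSubgroup_cyc.1 hσ]

/-! ### The fields `ℚ(ζ_{b p^∞}) ∩ F` and the layers -/

theorem le_cyc_of_conductor_eq {F : IntermediateField ℚ Qbar} {N : ℕ} [NeZero N]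
    (h : conductor F = N) : F ≤ cyc N := by
  have hne : {f : ℕ | ∃ _ : NeZero f, F ≤ cyc f}.Nonempty := by
    -- The infimum of the empty set is `0`, so a nonzero conductor already ensures that `F` lies in
    -- some cyclotomic field.
    by_contra h'
    rw [Set.not_nonempty_iff_eq_empty] at h'
    rw [conductor, h', Nat.sInf_empty] at h
    exact NeZero.ne N h.symm
  have := Nat.sInf_mem hne
  rw [← conductor, h] at this
  exact this.2

/-- With `d = b c`, the gcd is `b * gcd (p^k, c p^n)`, and `p^k` is prime to `c`. The bound does not
depend on `k`, which is what permits a passage to `ℚ(ζ_{bp^∞})`. -/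
theorem gcd_mul_pow {p b d k n : ℕ} (hp : p.Prime) (hd : ¬ p ∣ d) (hbd : b ∣ d) :
    (b * p ^ k).gcd (d * p ^ n) ∣ b * p ^ n := by
  have hc : Nat.Coprime (p ^ k) d := Nat.Coprime.pow_left k ((Nat.Prime.coprime_iff_not_dvd hp).2 hd)
  obtain ⟨c, rfl⟩ := hbd
  rw [mul_assoc, Nat.gcd_mul_left]
  refine Nat.mul_dvd_mul_left b ?_
  have hc' : Nat.Coprime (p ^ k) c := hc.coprime_dvd_right (Nat.dvd_mul_left _ _)
  exact (hc'.coprime_dvd_left (Nat.gcd_dvd_left _ _)).dvd_of_dvd_mul_left (Nat.gcd_dvd_right _ _)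

theorem layer_le_cyc {F : IntermediateField ℚ Qbar} {p a d : ℕ} [Fact p.Prime] [NeZero d]
    (hF : F ≤ cyc (d * p ^ a)) {n : ℕ} (hn : a ≤ n) : layer F p n ≤ cyc (d * p ^ n) :=
  sup_le (hF.trans (cyc_le_of_dvd (Nat.mul_dvd_mul_left d (pow_dvd_pow p hn))))
    (cyc_le_of_dvd (Nat.dvd_mul_left _ _))

theorem cyc_mul_pow_mono (p : ℕ) [Fact p.Prime] (b : ℕ) [NeZero b] :
    Monotone fun n => cyc (b * p ^ n) :=
  fun _ _ h => cyc_le_of_dvd (Nat.mul_dvd_mul_left b (pow_dvd_pow p h))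

theorem cyc_le_cycInf (p : ℕ) [Fact p.Prime] (b : ℕ) [NeZero b] (n : ℕ) :
    cyc (b * p ^ n) ≤ cycInf p b :=
  le_iSup (fun n => cyc (b * p ^ n)) n

/-- An element of the directed union lies in some `ℚ(ζ_{bp^k})` and in `ℚ(ζ_{dp^a})`, hence in
`ℚ(ζ_{bp^a})`. Thus the infinite tower can be replaced by any level `n ≥ a`. -/
theorem cycInf_inf_le {F : IntermediateField ℚ Qbar} {p a d b : ℕ} [Fact p.Prime] [NeZero d]
    [NeZero b] (hF : F ≤ cyc (d * p ^ a)) (hd : ¬ p ∣ d) (hbd : b ∣ d) {n : ℕ} (hn : a ≤ n) :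
    cycInf p b ⊓ F ≤ cyc (b * p ^ n) := by
  rintro x ⟨hx, hxF⟩
  have hx' : x ∈ cycInf p b := hx
  rw [cycInf, ← SetLike.mem_coe,
    IntermediateField.coe_iSup_of_directed (cyc_mul_pow_mono p b).directed_le] at hx'
  obtain ⟨k, hk⟩ := Set.mem_iUnion.1 hx'
  have := cyc_inf_cyc_le (gcd_mul_pow Fact.out hd hbd : (b * p ^ k).gcd (d * p ^ a) ∣ b * p ^ a)
    ⟨hk, hF hxF⟩
  exact cyc_mul_pow_mono p b hn this

/-- There is an automorphism of `Qbar` raising all the roots of unity `ζ_{b p^n}` to the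
power `l`. -/
theorem exists_frobenius (p b l : ℕ) [Fact p.Prime] [NeZero b] (hb : l.Coprime b)
    (hp : l.Coprime p) :
    ∃ τ : Gal(Qbar/ℚ), ∀ n : ℕ, τ (zeta (b * p ^ n)) = zeta (b * p ^ n) ^ l := by
  let C : ℕ → Set Gal(Qbar/ℚ) := fun n => {τ | τ (zeta (b * p ^ n)) = zeta (b * p ^ n) ^ l}
  have hclosed (n : ℕ) : IsClosed (C n) := by
    obtain ⟨τ, hτ⟩ := exists_aut_pow (b * p ^ n)
      (Nat.Coprime.mul_right hb (Nat.Coprime.pow_right n hp))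
    have : C n = (fun σ => τ⁻¹ * σ) ⁻¹' ((cyc (b * p ^ n)).fixingSubgroup : Set Gal(Qbar/ℚ)) := by
      ext σ
      rw [Set.mem_preimage, SetLike.mem_coe, mem_fixingSubgroup_cyc, AlgEquiv.mul_apply]
      change σ _ = _ ↔ τ.symm _ = _
      rw [AlgEquiv.symm_apply_eq, hτ]
    rw [this]
    exact (IntermediateField.fixingSubgroup_isClosed _).preimage (by fun_prop)
  -- The conditions at the successive levels cut out a decreasing sequence of nonempty closed
  -- subsets of a compact group.
  obtain ⟨τ, hτ⟩ := IsCompact.nonempty_iInter_of_sequence_nonempty_isCompact_isClosed C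
    (fun n τ hτ => map_zeta_of_dvd (Nat.mul_dvd_mul_left b (pow_dvd_pow p n.le_succ)) hτ)
    (fun n => exists_aut_pow (b * p ^ n)
      (Nat.Coprime.mul_right hb (Nat.Coprime.pow_right n hp)))
    (hclosed 0).isCompact hclosed
  exact ⟨τ, fun n => Set.mem_iInter.1 hτ n⟩

end CycloElt

/-! ### The field `Ω_S` is normal -/

namespace CycloElt

/-- Conjugation by `σ⁻¹` carries the inertia group of `𝔓` to that of `σ⁻¹ 𝔓`, another maximal ideal
not containing `p`, and it preserves `Gal(Qbar/F)` because `F` is normal. -/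
instance (F : IntermediateField ℚ Qbar) (p : ℕ) [Normal ℚ F] : Normal ℚ (Omega F p) := by
  rw [normal_iff_map_mem]
  intro σ x hx
  rw [mem_Omega_iff] at hx ⊢
  intro 𝔓 h𝔓 hp ρ hρ hρ'
  let φ : NumberField.RingOfIntegers Qbar ≃+* NumberField.RingOfIntegers Qbar :=
    MulSemiringAction.toRingEquiv Gal(Qbar/ℚ) (NumberField.RingOfIntegers Qbar) σ
  have h1 := hx (𝔓.comap φ) (Ideal.comap_isMaximal_of_equiv φ) (by
    rwa [Ideal.mem_comap, map_natCast]) (σ⁻¹ * ρ * σ) (by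
      have h2 := (inferInstance : F.fixingSubgroup.Normal).conj_mem ρ hρ σ⁻¹
      rwa [inv_inv] at h2) (fun y => by
        change φ ((σ⁻¹ * ρ * σ) • y - y) ∈ 𝔓
        have h3 : φ ((σ⁻¹ * ρ * σ) • y - y) = ρ • (σ • y) - σ • y := by
          change σ • ((σ⁻¹ * ρ * σ) • y - y) = _
          rw [smul_sub, smul_smul, ← mul_assoc, ← mul_assoc, mul_inv_cancel, one_mul, mul_smul]
        rw [h3]
        exact hρ' (σ • y))
  have h4 := congrArg σ h1
  exact (σ.apply_symm_apply (ρ (σ x))).symm.trans h4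

/-- The restriction of automorphisms of `Qbar` to `Ω_S`. -/
noncomputable def res (F : IntermediateField ℚ Qbar) (p : ℕ) [Normal ℚ F] :
    Gal(Qbar/ℚ) →* Gal(Omega F p/ℚ) :=
  AlgEquiv.restrictNormalHom (Omega F p)

theorem res_apply {F : IntermediateField ℚ Qbar} {p : ℕ} [Normal ℚ F] (σ : Gal(Qbar/ℚ))
    (x : Omega F p) : (res F p σ x : Qbar) = σ x :=
  AlgEquiv.restrictNormal_commutes σ (Omega F p) x

theorem res_surjective (F : IntermediateField ℚ Qbar) (p : ℕ) [Normal ℚ F] :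
    Function.Surjective (res F p) :=
  AlgEquiv.restrictNormalHom_surjective Qbar

theorem res_mem_galOver_iff {F : IntermediateField ℚ Qbar} {p : ℕ} [Normal ℚ F]
    {K : IntermediateField ℚ Qbar} (hK : K ≤ Omega F p) {σ : Gal(Qbar/ℚ)} :
    res F p σ ∈ galOver F p K ↔ σ ∈ K.fixingSubgroup := by
  rw [mem_galOver_iff, mem_fixingSubgroup]
  refine ⟨fun h x hx => ?_, fun h x hx => Subtype.ext ?_⟩
  · rw [← res_apply σ (⟨x, hK hx⟩ : Omega F p), h _ hx]
  · rw [res_apply, h _ hx]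

theorem galOver_anti {F : IntermediateField ℚ Qbar} {p : ℕ} {K L : IntermediateField ℚ Qbar}
    (h : K ≤ L) : galOver F p L ≤ galOver F p K :=
  fun _ hσ => mem_galOver_iff.2 fun x hx => mem_galOver_iff.1 hσ x (h hx)

/-- Cohomological sums run over cosets in `Gal(Ω_S/ℚ)` while `fieldNorm_eq_prod` uses `Gal(Qbar/ℚ)`;
lifting representatives connects the two. -/
theorem IsTransversal.of_res {F : IntermediateField ℚ Qbar} {p : ℕ} [Normal ℚ F]
    {K L : IntermediateField ℚ Qbar} (hK : K ≤ Omega F p) (hL : L ≤ Omega F p) {ι : Type*}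
    {s : ι → Gal(Omega F p/ℚ)} (hs : IsTransversal (galOver F p K) (galOver F p L) s)
    {t : ι → Gal(Qbar/ℚ)} (ht : ∀ i, res F p (t i) = s i) :
    IsTransversal K.fixingSubgroup L.fixingSubgroup t where
  mem i := by
    rw [← res_mem_galOver_iff hK, ht]
    exact hs.mem i
  exists_mem v hv := by
    obtain ⟨i, hi⟩ := hs.exists_mem _ ((res_mem_galOver_iff hK).2 hv)
    refine ⟨i, ?_⟩
    rwa [← res_mem_galOver_iff hL, map_mul, map_inv, ht]
  inj i j h := by
    rw [← res_mem_galOver_iff hL, map_mul, map_inv, ht, ht] at h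
    exact hs.inj i j h

/-! ### Kummer classes -/

variable {F : IntermediateField ℚ Qbar} {p : ℕ} [Fact p.Prime]

/-- Any `p^m`-th root `w` of `u` computes the Kummer cocycle, because it differs from the chosen
root by a power of `ζ_{p^m}`, which `g` fixes. Later proofs choose convenient roots. -/
theorem kummerZ1_eq_iff {r m : ℕ} (u : pUnits p (layer F p m)) {w : Omega F p}
    (hw : (w : Qbar) ^ p ^ m = (u.1 : Qbar)) (g : galOver F p (layer F p m)) (k : ℕ) :
    (kummerZ1 F p r m u).1 g = k ↔ (g.1 w : Qbar) = zeta (p ^ m) ^ k * w := by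
  have hr0 : ((root u : Omega F p) : Qbar) ≠ 0 := by simp
  obtain ⟨i, -, hi⟩ := (zeta_primitive (p ^ m)).eq_pow_of_pow_eq_one
    (show ((w : Qbar) / (root u : Omega F p)) ^ p ^ m = 1 by
      rw [div_pow, hw, root_pow, div_self u.1.ne_zero])
  have hwi : w = (⟨zeta (p ^ m), zeta_mem_Omega F p m⟩ : Omega F p) ^ i * root u := by
    apply Subtype.ext
    push_cast
    rw [hi, div_mul_cancel₀ _ hr0]
  have hz : g.1 (⟨zeta (p ^ m), zeta_mem_Omega F p m⟩ : Omega F p) =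
      ⟨zeta (p ^ m), zeta_mem_Omega F p m⟩ :=
    mem_galOver_iff.1 g.2 _ ((le_sup_right : cyc (p ^ m) ≤ layer F p m) (zeta_mem_cyc _))
  have hgw : (g.1 w : Qbar) = zeta (p ^ m) ^ i * (g.1 (root u : Omega F p) : Qbar) := by
    rw [hwi, map_mul, map_pow, hz]
    rfl
  have hw' : (w : Qbar) = zeta (p ^ m) ^ i * ((root u : Omega F p) : Qbar) := by
    rw [hwi]
    rfl
  have hzi : zeta (p ^ m) ^ i ≠ 0 := pow_ne_zero _ (zeta_ne_zero _)
  refine (rootLog_eq_iff (p ^ m) _ (root_quotient u g) k).trans ?_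
  rw [hgw, hw']
  push_cast
  rw [div_eq_iff hr0, mul_left_comm, mul_right_inj' hzi]

/-- The Kummer map, as a homomorphism. -/
noncomputable def kummerHom (F : IntermediateField ℚ Qbar) (p : ℕ) [Fact p.Prime] (r m : ℕ) :
    Additive (pUnits p (layer F p m)) →+
      ContH1.Z1 (twist F p r m) (galOver F p (layer F p m)) :=
  AddMonoidHom.mk' (fun u => kummerZ1 F p r m u.toMul) fun u v => by
    refine Subtype.ext (funext fun g => ?_)
    set a := (kummerZ1 F p r m u.toMul).1 g with ha
    set b := (kummerZ1 F p r m v.toMul).1 g with hb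
    have h1 := (kummerZ1_eq_iff (r := r) u.toMul (root_pow u.toMul) g a.val).1 (by rw [ZMod.natCast_zmod_val])
    have h2 := (kummerZ1_eq_iff (r := r) v.toMul (root_pow v.toMul) g b.val).1 (by rw [ZMod.natCast_zmod_val])
    change (kummerZ1 F p r m (u.toMul * v.toMul)).1 g = a + b
    have hab : a + b = ((a.val + b.val : ℕ) : ZMod (p ^ m)) := by simp
    -- Independence of the root allows the product of the two chosen roots, so additivity holds for
    -- cocycles and not only for classes.
    rw [hab, kummerZ1_eq_iff 
      (w := (root u.toMul : Omega F p) * (root v.toMul : Omega F p))]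
    · rw [map_mul]
      push_cast
      rw [h1, h2]
      ring
    · push_cast
      rw [mul_pow, root_pow, root_pow]

/-- The component at level `m` of the descent map. -/
noncomputable def alphaHom (F : IntermediateField ℚ Qbar) [FiniteDimensional ℚ F] (p : ℕ)
    [Fact p.Prime] (r m : ℕ) : Additive (pUnits p (layer F p m)) →+ H1Mod F p r m :=
  (ContH1.cor (twist F p r m) (galOver F p (layer F p m)) (galOver F p F)
    (isOpen_galOver F p (layer F p m))).comp
    ((ContH1.H1.mk (twist F p r m) (galOver F p (layer F p m))).comp (kummerHom F p r m))

theorem alphaHom_ofMul [FiniteDimensional ℚ F] (r m : ℕ) (u : pUnits p (layer F p m)) :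
    alphaHom F p r m (Additive.ofMul u) =
      ContH1.cor (twist F p r m) (galOver F p (layer F p m)) (galOver F p F)
        (isOpen_galOver F p (layer F p m)) (ContH1.H1.mk _ _ (kummerZ1 F p r m u)) :=
  rfl

/-- The action of an automorphism on the `p`-units of a normal field. -/
noncomputable def galUnit (p : ℕ) {K : IntermediateField ℚ Qbar} [Normal ℚ K] (τ : Gal(Qbar/ℚ))
    (u : pUnits p K) : pUnits p K :=
  ⟨Units.map (τ : Qbar →* Qbar) u.1, by
    have h {x : Qbar} (hx : IsPIntegral p x) : IsPIntegral p (τ x) := by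
      obtain ⟨k, hk⟩ := hx
      refine ⟨k, ?_⟩
      have := hk.map (τ.toAlgHom.restrictScalars ℤ)
      simpa using this
    refine ⟨map_mem τ u.2.1, h u.2.2.1, ?_⟩
    rw [← map_inv]
    exact h u.2.2.2⟩

theorem twist_eq_pow (r m : ℕ) [Normal ℚ F] {τ : Gal(Qbar/ℚ)} {k : ℕ}
    (hk : τ (zeta (p ^ m)) = zeta (p ^ m) ^ k) :
    (twist F p r m (res F p τ) : ZMod (p ^ m)) = (k : ZMod (p ^ m)) ^ r := by
  have hz : IsPrimitiveRoot (⟨zeta (p ^ m), zeta_mem_Omega F p m⟩ : Omega F p) (p ^ m) :=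
    IsPrimitiveRoot.coe_submonoidClass_iff.1 (zeta_primitive (p ^ m))
  have h1 := cyclotomicCharacter.spec p (n := m) (res F p τ : Omega F p ≃+* Omega F p) _
    hz.pow_eq_one
  have h2 := congrArg Subtype.val h1
  have h3 : (res F p τ ⟨zeta (p ^ m), zeta_mem_Omega F p m⟩ : Qbar) = zeta (p ^ m) ^ k :=
    (res_apply _ _).trans hk
  have h4 := zeta_pow_eq_iff.1 (h2.symm.trans h3)
  rw [← ZMod.natCast_eq_natCast_iff, ZMod.natCast_zmod_val] at h4
  change PadicInt.toZModPow m ((kappa F p (res F p τ) ^ r : ℤ_[p]ˣ) : ℤ_[p]) = _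
  rw [Units.val_pow_eq_pow_val, map_pow]
  exact congrArg (· ^ r) h4

/-- Equivariance of the Kummer map. -/
theorem conj_kummer [Normal ℚ F] {r m : ℕ} (hr : r ≠ 0) {τ : Gal(Qbar/ℚ)} {k : ℕ}
    (hk : τ (zeta (p ^ m)) = zeta (p ^ m) ^ k) (u : pUnits p (layer F p m)) :
    ContH1.conj (twist F p r m) (galOver F p (layer F p m)) (res F p τ)
        (ContH1.H1.mk _ _ (kummerZ1 F p r m u)) =
      k ^ (r - 1) • ContH1.H1.mk _ _ (kummerZ1 F p r m (galUnit p τ u)) := by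
  rw [← map_nsmul]
  refine congrArg (ContH1.H1.mk (twist F p r m) (galOver F p (layer F p m)))
    (Subtype.ext (funext fun h => ?_))
  set σ := res F p τ with hσ
  change (twist F p r m σ : ZMod (p ^ m)) * (kummerZ1 F p r m u).1 (MulAut.conjNormal σ⁻¹ h) =
    k ^ (r - 1) • (kummerZ1 F p r m (galUnit p τ u)).1 h
  set j := (kummerZ1 F p r m u).1 (MulAut.conjNormal σ⁻¹ h) with hj
  have h1 := (kummerZ1_eq_iff (r := r) u (root_pow u) (MulAut.conjNormal σ⁻¹ h) j.val).1
    (by rw [ZMod.natCast_zmod_val])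
  -- `σ (root u)` is a root of `τ u`, and `h σ = σ (σ⁻¹ h σ)` multiplies it by `σ (ζ^j) = ζ^(k j)`.
  -- The conjugated cocycle has value `k^r j`, so `k^(r-1)` remains.
  have h2 : (kummerZ1 F p r m (galUnit p τ u)).1 h = ((k * j.val : ℕ) : ZMod (p ^ m)) := by
    rw [kummerZ1_eq_iff (w := σ (root u : Omega F p))]
    · have h3 : h.1 (σ (root u : Omega F p)) =
          σ ((MulAut.conjNormal σ⁻¹ h : galOver F p (layer F p m)).1 (root u : Omega F p)) := by
        rw [MulAut.conjNormal_apply, inv_inv, ← AlgEquiv.mul_apply, ← AlgEquiv.mul_apply]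
        congr 1
        group
      rw [h3, hσ, res_apply, h1, map_mul, map_pow, hk, res_apply, ← pow_mul]
    · rw [hσ, res_apply, ← map_pow, root_pow]
      rfl
  rw [h2, hσ, twist_eq_pow r m hk, nsmul_eq_mul]
  push_cast
  rw [ZMod.natCast_zmod_val, ← mul_assoc, ← pow_succ, Nat.sub_add_cancel (by omega)]

theorem conj_alphaHom [FiniteDimensional ℚ F] [Normal ℚ F] {r m : ℕ} (hr : r ≠ 0)
    {τ : Gal(Qbar/ℚ)} {k : ℕ} (hk : τ (zeta (p ^ m)) = zeta (p ^ m) ^ k)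
    (u : pUnits p (layer F p m)) :
    ContH1.conj (twist F p r m) (galOver F p F) (res F p τ)
        (alphaHom F p r m (Additive.ofMul u)) =
      k ^ (r - 1) • alphaHom F p r m (Additive.ofMul (galUnit p τ u)) := by
  rw [alphaHom_ofMul, alphaHom_ofMul]
  refine (ContH1.conj_cor (twist F p r m) (galOver F p (layer F p m)) (galOver F p F)
    (isOpen_galOver F p (layer F p m)) _ _).trans ?_
  refine (congrArg _ (conj_kummer hr hk u)).trans ?_
  rw [map_nsmul]

/-! ### Corestriction of Kummer classes and norms of units -/

theorem galOver_layer_le (F : IntermediateField ℚ Qbar) (p : ℕ) [Fact p.Prime] {m n : ℕ}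
    (h : m ≤ n) : galOver F p (layer F p n) ≤ galOver F p (layer F p m) :=
  galOver_anti (layer_mono F p h)

/-- `h` permutes the cosets and moves each representative by a shift in `U`, so the exponents `a q`
add up. This matches the sum defining corestriction with the Kummer cocycle of a product of
conjugates. -/
theorem map_prod_out {k K : Type*} [Field k] [Field K] [Algebra k K] {U V : Subgroup Gal(K/k)}
    [Fintype (V ⧸ U.subgroupOf V)] (v ζ : K) (a : V ⧸ U.subgroupOf V → ℕ) (h : V)
    (hζ : ∀ g : V, g.1 ζ = ζ)
    (hshift : ∀ q, (ContH1.cosetShift U V h q : Gal(K/k)) v = ζ ^ a q * v) :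
    h.1 (∏ q : V ⧸ U.subgroupOf V, (q.out : V).1 v) =
      ζ ^ (∑ q, a q) * ∏ q : V ⧸ U.subgroupOf V, (q.out : V).1 v := by
  rw [map_prod, ← Finset.prod_pow_eq_pow_sum,
    ← Equiv.prod_comp (MulAction.toPerm h) fun q : V ⧸ U.subgroupOf V => (q.out : V).1 v,
    ← Finset.prod_mul_distrib]
  refine Finset.prod_congr rfl fun q _ => ?_
  have h4 := DFunLike.congr_fun (ContH1.coe_cosetShift U V h q) v
  rw [AlgEquiv.mul_apply, AlgEquiv.mul_apply, hshift, map_mul, map_pow, hζ] at h4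
  exact h4.symm

/-- The corestriction of a Kummer class from `F_{m+1}` to `F_m`, modulo `p ^ m`, is the Kummer
class of the norm. -/
theorem cor_kummer [FiniteDimensional ℚ F] [Normal ℚ F] (r m : ℕ)
    (u : pUnits p (layer F p (m + 1))) :
    ContH1.cor (twist F p r m) (galOver F p (layer F p (m + 1))) (galOver F p (layer F p m))
        (isOpen_galOver F p (layer F p (m + 1)))
        (ContH1.coeffMap (twist F p r (m + 1)) (twist F p r m)
          (ZMod.castHom (pow_dvd_pow p m.le_succ) (ZMod (p ^ m))) (castHom_twist F p r m)
          (galOver F p (layer F p (m + 1))) (ContH1.H1.mk _ _ (kummerZ1 F p r (m + 1) u))) =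
      ContH1.H1.mk _ _ (kummerZ1 F p r m (unitNorm p (layer_mono F p m.le_succ) u)) := by
  set U := galOver F p (layer F p (m + 1)) with hU
  set V := galOver F p (layer F p m) with hV
  have := Fintype.ofFinite (V ⧸ U.subgroupOf V)
  refine congrArg (ContH1.H1.mk (twist F p r m) V) (Subtype.ext (funext fun h => ?_))
  change ∑ᶠ q : V ⧸ U.subgroupOf V, (twist F p r m ((h • q).out : V) : ZMod (p ^ m)) *
    ZMod.castHom (pow_dvd_pow p m.le_succ) (ZMod (p ^ m))
      ((kummerZ1 F p r (m + 1) u).1 (ContH1.cosetShift U V h q)) = _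
  let a : V ⧸ U.subgroupOf V → ZMod (p ^ (m + 1)) := fun q =>
    (kummerZ1 F p r (m + 1) u).1 (ContH1.cosetShift U V h q)
  have h1 : ∑ᶠ q : V ⧸ U.subgroupOf V, (twist F p r m ((h • q).out : V) : ZMod (p ^ m)) *
      ZMod.castHom (pow_dvd_pow p m.le_succ) (ZMod (p ^ m)) (a q) =
      ((∑ q, (a q).val : ℕ) : ZMod (p ^ m)) := by
    rw [finsum_eq_sum_of_fintype, Nat.cast_sum]
    refine Finset.sum_congr rfl fun q _ => ?_
    -- The representatives lie over `F_m ∋ ζ_{p^m}`, so they act trivially on `ℤ/p^m(r)` and the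
    -- weights disappear.
    rw [twist_eq_one r m ((h • q).out : V).2, Units.val_one, one_mul, ZMod.castHom_apply,
      ZMod.natCast_val]
  refine h1.trans (Eq.symm ?_)
  -- The chosen root is a `p^(m+1)`-th root of `u`, so its `p`-th power is a `p^m`-th root, and
  -- `ζ_{p^(m+1)}^p = ζ_{p^m}` turns the cocycle modulo `p^(m+1)` into its reduction.
  let v : Omega F p := (root u : Omega F p) ^ p
  let ζ : Omega F p := ⟨zeta (p ^ m), zeta_mem_Omega F p m⟩
  have hshift (q : V ⧸ U.subgroupOf V) :
      (ContH1.cosetShift U V h q : Gal(Omega F p/ℚ)) v = ζ ^ (a q).val * v := by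
    have h2 := (kummerZ1_eq_iff (r := r) u (root_pow u) (ContH1.cosetShift U V h q) (a q).val).1
      (by simp [a])
    apply Subtype.ext
    rw [map_pow]
    push_cast
    rw [h2, mul_pow, ← pow_mul, mul_comm _ p, pow_mul, zeta_pow_prime (pow_succ' p m)]
    rfl
  have hζ (g : V) : g.1 ζ = ζ :=
    mem_galOver_iff.1 g.2 _ ((le_sup_right : cyc (p ^ m) ≤ layer F p m) (zeta_mem_cyc _))
  -- The product of the conjugates of `v` over `F_m` is a `p^m`-th root of the norm of `u`.
  rw [kummerZ1_eq_iff (w := ∏ q : V ⧸ U.subgroupOf V, (q.out : V).1 v)]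
  · rw [map_prod_out v ζ (fun q => (a q).val) h hζ hshift]
    rfl
  · choose t ht using fun q : V ⧸ U.subgroupOf V => res_surjective F p (q.out : V).1
    have hT := (isTransversal_out V U).of_res (layer_le_Omega F p m) (layer_le_Omega F p (m + 1)) ht
    refine Eq.trans ?_ (fieldNorm_eq_prod (layer_mono F p m.le_succ) hT ⟨u.1, u.2.1⟩).symm
    push_cast
    rw [← Finset.prod_pow]
    refine Finset.prod_congr rfl fun q _ => ?_
    rw [← ht, res_apply, ← map_pow]
    congr 1
    change ((root u : Omega F p) ^ p : Qbar) ^ p ^ m = _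
    rw [← pow_mul, ← pow_succ', root_pow]

/-- Corestriction from `F_{m+1}` to `F` passes through `F_m`, where `cor_kummer` applies. -/
theorem coeffMap_alphaHom [FiniteDimensional ℚ F] [Normal ℚ F] (r m : ℕ)
    (u : pUnits p (layer F p (m + 1))) :
    ContH1.coeffMap (twist F p r (m + 1)) (twist F p r m)
        (ZMod.castHom (pow_dvd_pow p m.le_succ) (ZMod (p ^ m))) (castHom_twist F p r m)
        (galOver F p F) (alphaHom F p r (m + 1) (Additive.ofMul u)) =
      alphaHom F p r m (Additive.ofMul (unitNorm p (layer_mono F p m.le_succ) u)) := by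
  rw [alphaHom_ofMul, alphaHom_ofMul]
  refine (ContH1.coeffMap_cor (twist F p r (m + 1)) (twist F p r m) _ (castHom_twist F p r m)
    (galOver F p (layer F p (m + 1))) (galOver F p F)
    (isOpen_galOver F p (layer F p (m + 1))) _).trans ?_
  refine Eq.trans ?_ (congrArg (ContH1.cor (twist F p r m) (galOver F p (layer F p m))
    (galOver F p F) (isOpen_galOver F p (layer F p m))) (cor_kummer r m u))
  exact (ContH1.cor_cor _ _ _ _ (galOver_layer_le F p m.le_succ) (galOver_anti le_sup_left)
    _ _ _).symm

end CycloElt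

/-! ### The norm coherent sequences -/

namespace CycloElt

instance (K L : IntermediateField ℚ Qbar) [hK : Normal ℚ K] [hL : Normal ℚ L] :
    Normal ℚ (K ⊓ L : IntermediateField ℚ Qbar) := by
  rw [normal_iff_map_mem] at hK hL ⊢
  exact fun σ x hx => ⟨hK σ x hx.1, hL σ x hx.2⟩

instance (p b : ℕ) [Fact p.Prime] [NeZero b] : Normal ℚ (cycInf p b) := by
  rw [normal_iff_map_mem]
  intro σ x hx
  have : cycInf p b ≤ (cycInf p b).comap (σ : Qbar →ₐ[ℚ] Qbar) :=
    iSup_le fun n y hy => cyc_le_cycInf p b n (map_mem σ hy)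
  exact this hx

/-- Norms of normal extensions commute with automorphisms. -/
theorem fieldNorm_map {K L : IntermediateField ℚ Qbar} (h : K ≤ L) [FiniteDimensional ℚ L]
    [hK : Normal ℚ K] [hL : Normal ℚ L] (σ : Gal(Qbar/ℚ)) (x y : L) (hxy : (y : Qbar) = σ x) :
    (fieldNorm h y : Qbar) = σ (fieldNorm h x) := by
  have := Fintype.ofFinite (K.fixingSubgroup ⧸ L.fixingSubgroup.subgroupOf K.fixingSubgroup)
  have hs := isTransversal_out K.fixingSubgroup L.fixingSubgroup
  have hs' : IsTransversal K.fixingSubgroup L.fixingSubgroup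
      fun q : K.fixingSubgroup ⧸ L.fixingSubgroup.subgroupOf K.fixingSubgroup =>
        σ * (q.out : Gal(Qbar/ℚ)) * σ⁻¹ := by
    have hKn : K.fixingSubgroup.Normal := inferInstance
    have hLn : L.fixingSubgroup.Normal := inferInstance
    refine ⟨fun q => hKn.conj_mem _ (hs.mem q) σ, fun v hv => ?_, fun q q' hq => ?_⟩
    · obtain ⟨q, hq⟩ := hs.exists_mem (σ⁻¹ * v * σ⁻¹⁻¹) (hKn.conj_mem v hv σ⁻¹)
      refine ⟨q, ?_⟩
      convert hLn.conj_mem _ hq σ using 1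
      group
    · refine hs.inj q q' ?_
      convert hLn.conj_mem _ hq σ⁻¹ using 1
      group
  rw [fieldNorm_eq_prod h hs x, fieldNorm_eq_prod h hs' y, map_prod]
  refine Finset.prod_congr rfl fun q _ => ?_
  rw [hxy, AlgEquiv.mul_apply, AlgEquiv.mul_apply]
  exact congrArg (fun z => σ ((q.out : Gal(Qbar/ℚ)) z)) (σ.symm_apply_apply (x : Qbar))

variable {F : IntermediateField ℚ Qbar} {p : ℕ} [Fact p.Prime]

theorem epsTop_mem_cyc (b : ℕ) [NeZero b] {n : ℕ} (hn : n ≠ 0) :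
    ((epsTop F p b n hn).1 : Qbar) ∈ cyc (b * p ^ n) :=
  (fieldNorm (inf_le_right : layer F p n ⊓ cyc (b * p ^ n) ≤ cyc (b * p ^ n))
    ⟨1 - zeta (b * p ^ n), (oneSubZeta p b n hn).2.1⟩).2.2

theorem coe_epsTop (b : ℕ) [NeZero b] {n : ℕ} (hn : n ≠ 0) (x : cyc (b * p ^ n))
    (hx : (x : Qbar) = 1 - zeta (b * p ^ n)) :
    ((epsTop F p b n hn).1 : Qbar) =
      fieldNorm (inf_le_right : layer F p n ⊓ cyc (b * p ^ n) ≤ cyc (b * p ^ n)) x := by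
  obtain ⟨x, hx'⟩ := x
  subst hx
  rfl

theorem coe_unitNorm {K L : IntermediateField ℚ Qbar} (h : K ≤ L) (u : pUnits p L) :
    ((unitNorm p h u).1 : Qbar) = fieldNorm h ⟨u.1, u.2.1⟩ :=
  rfl

theorem pUnits_ext {p : ℕ} {K : IntermediateField ℚ Qbar} {u v : pUnits p K}
    (h : (u.1 : Qbar) = v.1) : u = v :=
  Subtype.ext (Units.ext h)

theorem unitNorm_unitNorm {K L M : IntermediateField ℚ Qbar} (h : K ≤ L) (h' : L ≤ M)
    [FiniteDimensional ℚ L] [FiniteDimensional ℚ M] (u : pUnits p M) :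
    unitNorm p h (unitNorm p h' u) = unitNorm p (h.trans h') u :=
  pUnits_ext (congrArg Subtype.val (fieldNorm_fieldNorm h h' ⟨u.1, u.2.1⟩))

/-- On `F_{n+1} ∩ ℚ(ζ_{bp^(n+1)})` the norm `F_{n+1} → F_n` is the norm to `F_n ∩ ℚ(ζ_{bp^n})`. By
transitivity it may be computed through `ℚ(ζ_{bp^n})`, where `1 - ζ_{bp^(n+1)}` has norm `1 -
ζ_{bp^n}`, as `p ∣ p^n` for `n ≥ 1`. -/
theorem unitNorm_epsTop [FiniteDimensional ℚ F] [Normal ℚ F] {a d b : ℕ} [NeZero d] [NeZero b]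
    (hF : F ≤ cyc (d * p ^ a)) (hd : ¬ p ∣ d) (hbd : b ∣ d) {n : ℕ} (hn : n ≠ 0) (han : a ≤ n) :
    unitNorm p (layer_mono F p n.le_succ) (epsTop F p b (n + 1) n.succ_ne_zero) =
      epsTop F p b n hn := by
  apply pUnits_ext
  have hc : cyc (b * p ^ n) ≤ cyc (b * p ^ (n + 1)) := cyc_mul_pow_mono p b n.le_succ
  have hK : layer F p n ⊓ cyc (b * p ^ n) ≤ layer F p (n + 1) ⊓ cyc (b * p ^ (n + 1)) :=
    inf_le_inf (layer_mono F p n.le_succ) hc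
  let x : cyc (b * p ^ (n + 1)) := ⟨1 - zeta (b * p ^ (n + 1)), sub_mem (one_mem _) (zeta_mem_cyc _)⟩
  rw [coe_unitNorm, fieldNorm_eq_of_inf (layer_mono F p n.le_succ) hK ?_ inf_le_left inf_le_left ?_
    _ (fieldNorm inf_le_right x) (coe_epsTop b n.succ_ne_zero x rfl),
    fieldNorm_fieldNorm, ← fieldNorm_fieldNorm inf_le_right hc]
  · exact (coe_epsTop b hn _ (fieldNorm_one_sub_zeta_of_dvd (by ring) (Fact.out : p.Prime)
      (Dvd.dvd.mul_left (dvd_pow_self p hn) b) hc x rfl)).symm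
  · refine sup_le (le_sup_of_le_left le_sup_left) (le_sup_of_le_right (le_inf le_sup_right ?_))
    exact cyc_le_of_dvd (Nat.dvd_mul_left _ _)
  -- This is where `a ≤ n` enters: `F_n ⊆ ℚ(ζ_{dp^n})` meets `ℚ(ζ_{bp^(n+1)})` inside `ℚ(ζ_{bp^n})`.
  · refine le_inf inf_le_left (le_trans ?_ (cyc_inf_cyc_le (gcd_mul_pow (k := n + 1) Fact.out hd hbd)))
    exact le_inf (inf_le_right.trans inf_le_right) (inf_le_left.trans (layer_le_cyc hF han))

theorem eps_of_le {a b : ℕ} [NeZero b] {n : ℕ} (hn : n ≠ 0) (h : a ≤ n) :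
    eps F p a b n = epsTop F p b n hn :=
  dif_pos (by omega)

theorem eps_of_lt {a b N : ℕ} [NeZero b] {n : ℕ} (hN : max a 1 = N) (hN' : N ≠ 0) (h : n < N) :
    eps F p a b n = unitNorm p (layer_mono F p h.le) (epsTop F p b N hN') := by
  subst hN
  exact dif_neg (not_le.2 h)

theorem unitNorm_eps [FiniteDimensional ℚ F] [Normal ℚ F] {a d b : ℕ} [NeZero d] [NeZero b]
    (hF : F ≤ cyc (d * p ^ a)) (hd : ¬ p ∣ d) (hbd : b ∣ d) (n : ℕ) :
    unitNorm p (layer_mono F p n.le_succ) (eps F p a b (n + 1)) = eps F p a b n := by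
  by_cases h : max a 1 ≤ n
  · rw [eps_of_le n.succ_ne_zero (by omega), eps_of_le (by omega) (by omega),
      unitNorm_epsTop hF hd hbd (by omega) (by omega)]
  · by_cases h' : max a 1 ≤ n + 1
    · have h2 : max a 1 = n + 1 := by omega
      rw [eps_of_le n.succ_ne_zero (by omega), eps_of_lt h2 n.succ_ne_zero n.lt_succ_self]
    · have h2 : max a 1 ≠ 0 := by omega
      rw [eps_of_lt rfl h2 (not_le.1 h'), eps_of_lt rfl h2 (not_le.1 h), unitNorm_unitNorm]

/-! ### Systems of classes -/

theorem special_apply [FiniteDimensional ℚ F] (a r b : ℕ) [NeZero b] (m : ℕ) :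
    special F p a r b m = alphaHom F p r m (Additive.ofMul (eps F p a b m)) :=
  rfl

theorem special_mem_H1Zp [FiniteDimensional ℚ F] [Normal ℚ F] {a d b : ℕ} [NeZero d] [NeZero b]
    (hF : F ≤ cyc (d * p ^ a)) (hd : ¬ p ∣ d) (hbd : b ∣ d) (r : ℕ) :
    special F p a r b ∈ H1Zp F p r := by
  intro m
  rw [special_apply, special_apply, coeffMap_alphaHom, unitNorm_eps hF hd hbd]

theorem act_apply [Normal ℚ F] (r : ℕ) (σ : Gal(Omega F p/ℚ)) (x : ∀ m, H1Mod F p r m) (m : ℕ) :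
    act F p r σ x m = ContH1.conj (twist F p r m) (galOver F p F) σ (x m) :=
  rfl

theorem act_mul [Normal ℚ F] (r : ℕ) (σ τ : Gal(Omega F p/ℚ)) (x : ∀ m, H1Mod F p r m) :
    act F p r (σ * τ) x = act F p r σ (act F p r τ x) := by
  funext m
  exact ContH1.conj_mul_apply _ _ σ τ (x m)

theorem act_mem_H1Zp [Normal ℚ F] {r : ℕ} (σ : Gal(Omega F p/ℚ)) {x : ∀ m, H1Mod F p r m}
    (hx : x ∈ H1Zp F p r) : act F p r σ x ∈ H1Zp F p r := by
  intro m
  rw [act_apply, act_apply, ← hx m, ContH1.coeffMap_conj]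

theorem galNorm_mem_H1Zp [Normal ℚ F] {r : ℕ} (L K : IntermediateField ℚ Qbar)
    {x : ∀ m, H1Mod F p r m} (hx : x ∈ H1Zp F p r) : galNorm F p r L K x ∈ H1Zp F p r :=
  finsum_induction (· ∈ H1Zp F p r) (zero_mem _) (fun _ _ => add_mem) fun _ => act_mem_H1Zp _ hx

/-- Each component determines the previous one, so agreement at high levels propagates downwards.
This removes the levels below `max a 1`, where `eps` is defined by descent. -/
theorem H1Zp_ext {r : ℕ} {x y : ∀ m, H1Mod F p r m} (hx : x ∈ H1Zp F p r) (hy : y ∈ H1Zp F p r)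
    (M : ℕ) (h : ∀ m, M ≤ m → x m = y m) : x = y := by
  have key (k : ℕ) : ∀ m, M ≤ m + k → x m = y m := by
    induction k with
    | zero => exact h
    | succ k ih =>
      intro m hm
      rw [← hx m, ← hy m, ih (m + 1) (by omega)]
  exact funext fun m => key M m (by omega)

/-- An automorphism over `ℚ(ζ_{b p^∞}) ∩ F` can be modified by an automorphism over `F` to act
trivially on `ℚ(ζ_{b p^n})`. -/
theorem exists_mul_mem_fixingSubgroup_cyc [FiniteDimensional ℚ F] [Normal ℚ F] {b : ℕ} [NeZero b]
    (n : ℕ) {σ : Gal(Qbar/ℚ)} (hσ : σ ∈ (cycInf p b ⊓ F).fixingSubgroup) :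
    ∃ α ∈ F.fixingSubgroup, ∃ β ∈ (cyc (b * p ^ n)).fixingSubgroup, α * β = σ :=
  exists_mul_of_mem_fixingSubgroup_inf F (cyc (b * p ^ n))
    (IntermediateField.fixingSubgroup_antitone
      (le_inf (inf_le_right.trans (cyc_le_cycInf p b n)) inf_le_left) hσ)

theorem inf_le_Omega (F K : IntermediateField ℚ Qbar) (p : ℕ) : K ⊓ F ≤ Omega F p :=
  inf_le_right.trans (le_Omega F p)

/-- `α` restricts to an element of `G_S`, which acts trivially on `H¹(G_S, -)`, and `β` fixes
`ζ_{p^n}`, so its twist factor is `1`. -/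
theorem conj_res_alphaHom [FiniteDimensional ℚ F] [Normal ℚ F] {r : ℕ} (hr : r ≠ 0) {b n : ℕ}
    [NeZero b] {α β : Gal(Qbar/ℚ)} (hα : α ∈ F.fixingSubgroup)
    (hβ : β ∈ (cyc (b * p ^ n)).fixingSubgroup) (u : pUnits p (layer F p n)) :
    ContH1.conj (twist F p r n) (galOver F p F) (res F p (α * β))
      (alphaHom F p r n (Additive.ofMul u)) =
      alphaHom F p r n (Additive.ofMul (galUnit p β u)) := by
  have h1 : β (zeta (p ^ n)) = zeta (p ^ n) ^ 1 := map_zeta_of_dvd (Nat.dvd_mul_left _ b)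
    (by rw [mem_fixingSubgroup_cyc.1 hβ, pow_one])
  rw [map_mul, ContH1.conj_mul_apply,
    ContH1.conj_eq_self _ _ ((res_mem_galOver_iff (le_Omega F p)).2 hα), conj_alphaHom hr h1, one_pow, one_smul]

theorem act_special [FiniteDimensional ℚ F] [Normal ℚ F] {a d b : ℕ} [NeZero d] [NeZero b]
    (hF : F ≤ cyc (d * p ^ a)) (hd : ¬ p ∣ d) (hbd : b ∣ d) {r : ℕ} (hr : r ≠ 0)
    {σ : Gal(Omega F p/ℚ)} (hσ : σ ∈ galOver F p (cycInf p b ⊓ F)) :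
    act F p r σ (special F p a r b) = special F p a r b := by
  have hs := special_mem_H1Zp hF hd hbd r
  refine H1Zp_ext (act_mem_H1Zp σ hs) hs (max a 1) fun n hn => ?_
  obtain ⟨τ, rfl⟩ := res_surjective F p σ
  rw [res_mem_galOver_iff (inf_le_Omega F _ p)] at hσ
  obtain ⟨α, hα, β, hβ, rfl⟩ := exists_mul_mem_fixingSubgroup_cyc n hσ
  rw [act_apply, special_apply, conj_res_alphaHom hr hα hβ]
  congr 2
  apply pUnits_ext
  rw [eps_of_le (by omega) (by omega)]
  exact mem_fixingSubgroup.1 hβ _ (epsTop_mem_cyc b (by omega))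

/-! ### The norm relations -/

/-- Modified by automorphisms over `F` to act trivially on `ℚ(ζ_{b p^n})`, a system of
representatives for `Gal(L/K)`, where `L = ℚ(ζ_{c p^∞}) ∩ F` and `K = ℚ(ζ_{b p^∞}) ∩ F`, becomes
one for the Galois group of `F_n ∩ ℚ(ζ_{c p^n})` over `F_n ∩ ℚ(ζ_{b p^n})`. -/
theorem IsTransversal.layer [FiniteDimensional ℚ F] [Normal ℚ F] {a d b c : ℕ} [NeZero d]
    [NeZero b] [NeZero c] (hF : F ≤ cyc (d * p ^ a)) (hd : ¬ p ∣ d) (hcd : c ∣ d) (hbc : b ∣ c)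
    {n : ℕ} (han : a ≤ n) {ι : Type*} {t α β : ι → Gal(Qbar/ℚ)}
    (ht : IsTransversal (cycInf p b ⊓ F).fixingSubgroup (cycInf p c ⊓ F).fixingSubgroup t)
    (hα : ∀ i, α i ∈ F.fixingSubgroup) (hβ : ∀ i, β i ∈ (cyc (b * p ^ n)).fixingSubgroup)
    (h : ∀ i, α i * β i = t i) :
    IsTransversal (layer F p n ⊓ cyc (b * p ^ n)).fixingSubgroup
      (layer F p n ⊓ cyc (c * p ^ n)).fixingSubgroup β := by
  have hFn : F.fixingSubgroup.Normal := inferInstance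
  have hLn : (CycloElt.layer F p n).fixingSubgroup.Normal := inferInstance
  have hFL : F.fixingSubgroup ≤ (cycInf p c ⊓ F).fixingSubgroup :=
    IntermediateField.fixingSubgroup_antitone inf_le_right
  refine ⟨fun i => IntermediateField.fixingSubgroup_antitone inf_le_right (hβ i),
    fun v hv => ?_, fun i j hij => ht.inj i j ?_⟩
  -- Only the factor `γ`, which fixes `ζ_{bp^n}`, selects the coset; `φ` fixes `F_n` and is absorbed
  -- by normality.
  · obtain ⟨φ, hφ, γ, hγ, rfl⟩ := exists_mul_of_mem_fixingSubgroup_inf _ _ hv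
    obtain ⟨i, hi⟩ := ht.exists_mem γ (IntermediateField.fixingSubgroup_antitone
      (cycInf_inf_le hF hd (hbc.trans hcd) han) hγ)
    -- Replacing `t i = α i * β i` by `β i` introduces a conjugate of `α i`, which still fixes `F`.
    have h1 : (β i)⁻¹ * γ ∈ (cycInf p c ⊓ F).fixingSubgroup := by
      have h2 := mul_mem (hFL (hFn.conj_mem _ (hα i) (β i)⁻¹)) hi
      rw [← h] at h2
      convert h2 using 1
      group
    obtain ⟨φ', hφ', γ', hγ', h3⟩ := exists_mul_mem_fixingSubgroup_cyc n h1
    have hcn {x : Gal(Qbar/ℚ)} {e : ℕ} [NeZero e] (hx : x ∈ (cyc (e * p ^ n)).fixingSubgroup) :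
        x ∈ (cyc (p ^ n)).fixingSubgroup :=
      IntermediateField.fixingSubgroup_antitone (cyc_le_of_dvd (Nat.dvd_mul_left _ _)) hx
    -- `φ'` fixes `F` by construction; it also fixes `ζ_{p^n}`, since `β i`, `γ` and `γ'` all do.
    have h4 : φ' ∈ (CycloElt.layer F p n).fixingSubgroup := by
      rw [CycloElt.layer, IntermediateField.fixingSubgroup_sup]
      refine Subgroup.mem_inf.2 ⟨hφ', ?_⟩
      rw [eq_mul_inv_of_mul_eq h3]
      exact mul_mem (mul_mem (inv_mem (hcn (hβ i))) (hcn hγ)) (inv_mem (hcn hγ'))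
    refine ⟨i, ?_⟩
    have h5 := hLn.conj_mem _ hφ (β i)⁻¹
    have h6 : (β i)⁻¹ * (φ * γ) = (β i)⁻¹ * φ * (β i)⁻¹⁻¹ * φ' * γ' := by
      rw [mul_assoc _ φ' γ', h3]
      group
    rw [h6]
    exact mul_mem (IntermediateField.fixingSubgroup_antitone inf_le_left (mul_mem h5 h4))
      (IntermediateField.fixingSubgroup_antitone inf_le_right hγ')
  · have h1 : (β i)⁻¹ * β j ∈ (cycInf p c ⊓ F).fixingSubgroup :=
      IntermediateField.fixingSubgroup_antitone
        (le_inf (inf_le_right.trans le_sup_left) (cycInf_inf_le hF hd hcd han)) hij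
    have h2 := mul_mem (hFL (hFn.conj_mem _ (mul_mem (inv_mem (hα i)) (hα j)) (β i)⁻¹)) h1
    rw [← h, ← h]
    convert h2 using 1
    group

/-- The norm relation at the level `n`, in terms of norms of fields. -/
theorem galNorm_special_apply [FiniteDimensional ℚ F] [Normal ℚ F] {a d b c : ℕ} [NeZero d]
    [NeZero b] [NeZero c] (hF : F ≤ cyc (d * p ^ a)) (hd : ¬ p ∣ d) (hcd : c ∣ d) (hbc : b ∣ c)
    {r : ℕ} (hr : r ≠ 0) {n : ℕ} (hn : n ≠ 0) (han : a ≤ n)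
    (hc : cyc (b * p ^ n) ≤ cyc (c * p ^ n)) (x : cyc (c * p ^ n))
    (hx : (x : Qbar) = 1 - zeta (c * p ^ n)) :
    ∃ v : pUnits p (layer F p n),
      (v.1 : Qbar) = fieldNorm (inf_le_right : layer F p n ⊓ cyc (b * p ^ n) ≤ cyc (b * p ^ n))
        (fieldNorm hc x) ∧
      galNorm F p r (cycInf p c ⊓ F) (cycInf p b ⊓ F) (special F p a r c) n =
        alphaHom F p r n (Additive.ofMul v) := by
  set L := cycInf p c ⊓ F with hL
  set K := cycInf p b ⊓ F with hK
  have : FiniteDimensional ℚ L :=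
    inferInstanceAs (FiniteDimensional ℚ (cycInf p c ⊓ F : IntermediateField ℚ Qbar))
  have := Fintype.ofFinite (galOver F p K ⧸ (galOver F p L).subgroupOf (galOver F p K))
  choose t ht using fun q : galOver F p K ⧸ (galOver F p L).subgroupOf (galOver F p K) =>
    res_surjective F p (q.out : galOver F p K).1
  have hT := (isTransversal_out (galOver F p K) (galOver F p L)).of_res
    (inf_le_Omega F _ p) (inf_le_Omega F _ p) ht
  choose α hα β hβ h using fun q => exists_mul_mem_fixingSubgroup_cyc n (hT.mem q)
  have hT' := hT.layer hF hd hcd hbc han hα hβ h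
  -- The `β q` represent the Galois group between the two intersections with `F_n`, so this product
  -- is a norm of `ε_{c,n}`; computing it through `ℚ(ζ_{bp^n})` instead gives the stated form.
  refine ⟨∏ q, galUnit p (β q) (epsTop F p c n hn), ?_, ?_⟩
  · have hle : layer F p n ⊓ cyc (b * p ^ n) ≤ layer F p n ⊓ cyc (c * p ^ n) :=
      inf_le_inf le_rfl hc
    rw [fieldNorm_fieldNorm, ← fieldNorm_fieldNorm hle inf_le_right, fieldNorm_eq_prod hle hT',
      ← coe_epsTop c hn x hx]
    simp [galUnit]
  · rw [galNorm, finsum_eq_sum_of_fintype, Finset.sum_apply, ofMul_prod, map_sum]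
    refine Finset.sum_congr rfl fun q _ => ?_
    rw [act_apply, special_apply, ← ht, ← h q, conj_res_alphaHom hr (hα q) (hβ q),
      eps_of_le hn han]

theorem galNorm_special_of_dvd [FiniteDimensional ℚ F] [Normal ℚ F] {a d b l : ℕ} [NeZero d]
    [NeZero b] [Fact l.Prime] (hF : F ≤ cyc (d * p ^ a)) (hd : ¬ p ∣ d) (hlb : l * b ∣ d)
    {r : ℕ} (hr : r ≠ 0) (h : l ∣ b) :
    galNorm F p r (cycInf p (l * b) ⊓ F) (cycInf p b ⊓ F) (special F p a r (l * b)) =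
      special F p a r b := by
  refine H1Zp_ext (galNorm_mem_H1Zp _ _ (special_mem_H1Zp hF hd hlb r))
    (special_mem_H1Zp hF hd ((Nat.dvd_mul_left b l).trans hlb) r) (max a 1) fun n hn => ?_
  have hn0 : n ≠ 0 := by omega
  have hc : cyc (b * p ^ n) ≤ cyc (l * b * p ^ n) :=
    cyc_le_of_dvd (Nat.mul_dvd_mul_right (Nat.dvd_mul_left b l) _)
  let x : cyc (l * b * p ^ n) := ⟨1 - zeta (l * b * p ^ n), sub_mem (one_mem _) (zeta_mem_cyc _)⟩
  obtain ⟨v, hv, hv'⟩ := galNorm_special_apply hF hd hlb (Nat.dvd_mul_left b l) hr hn0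
    (by omega) hc x rfl
  rw [hv', special_apply, eps_of_le hn0 (by omega)]
  congr 2
  apply pUnits_ext
  rw [hv, ← coe_epsTop b hn0]
  exact fieldNorm_one_sub_zeta_of_dvd (mul_assoc _ _ _) (Fact.out : l.Prime)
    (h.mul_right _) hc x rfl

theorem res_inv_mul_mem_galOver [Normal ℚ F] {b : ℕ} [NeZero b]
    {σ : Gal(Omega F p/ℚ)} {τ : Gal(Qbar/ℚ)}
    (h : ∀ x : Omega F p, (x : Qbar) ∈ cycInf p b ⊓ F → (σ x : Qbar) = τ x) :
    (res F p τ)⁻¹ * σ ∈ galOver F p (cycInf p b ⊓ F) := by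
  refine mem_galOver_iff.2 fun x hx => ?_
  have h1 : σ x = res F p τ x := Subtype.ext ((h x hx).trans (res_apply τ x).symm)
  rw [AlgEquiv.mul_apply, h1]
  exact (res F p τ).symm_apply_apply x

/-- At level `n` the norm is the image of a unit `v` with `v * τ⁻¹ ε = ε`, where `τ` is a Frobenius
lift to `Qbar`. Additivity gives the difference, and equivariance under `τ`, which raises `ζ_{p^n}`
to the power `l`, produces `l^(r-1)`. -/
theorem galNorm_special_of_not_dvd [FiniteDimensional ℚ F] [Normal ℚ F] {a d b l : ℕ} [NeZero d]
    [NeZero b] [Fact l.Prime] (hF : F ≤ cyc (d * p ^ a)) (hd : ¬ p ∣ d) (hlb : l * b ∣ d)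
    {r : ℕ} (hr : r ≠ 0) (h : ¬ l ∣ b) {σ : Gal(Omega F p/ℚ)} (hσ : IsFrobenius F p l b σ) :
    galNorm F p r (cycInf p (l * b) ⊓ F) (cycInf p b ⊓ F) (special F p a r (l * b)) =
      special F p a r b - l ^ (r - 1) • act F p r σ⁻¹ (special F p a r b) := by
  have hb : b ∣ d := (Nat.dvd_mul_left b l).trans hlb
  have hs := special_mem_H1Zp hF hd hb r
  obtain ⟨τ, hτ, hστ⟩ := hσ
  -- The action on the special element depends only on the restriction to `ℚ(ζ_{bp^∞}) ∩ F`, so `σ`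
  -- may be replaced by the restriction of `τ`.
  have hact : act F p r σ⁻¹ (special F p a r b) =
      act F p r (res F p τ)⁻¹ (special F p a r b) := by
    have h1 := res_inv_mul_mem_galOver hστ
    have h2 := (inferInstance : (galOver F p (cycInf p b ⊓ F)).Normal).conj_mem _ (inv_mem h1)
      (res F p τ)
    have h3 : σ⁻¹ = (res F p τ)⁻¹ * (res F p τ * ((res F p τ)⁻¹ * σ)⁻¹ * (res F p τ)⁻¹) := by
      group
    rw [h3, act_mul, act_special hF hd hb hr h2]
  rw [hact]
  refine H1Zp_ext (galNorm_mem_H1Zp _ _ (special_mem_H1Zp hF hd hlb r))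
    (sub_mem hs (nsmul_mem (act_mem_H1Zp _ hs) _)) (max a 1) fun n hn => ?_
  have hn0 : n ≠ 0 := by omega
  have hc : cyc (b * p ^ n) ≤ cyc (l * b * p ^ n) :=
    cyc_le_of_dvd (Nat.mul_dvd_mul_right (Nat.dvd_mul_left b l) _)
  let x : cyc (l * b * p ^ n) := ⟨1 - zeta (l * b * p ^ n), sub_mem (one_mem _) (zeta_mem_cyc _)⟩
  obtain ⟨v, hv, hv'⟩ := galNorm_special_apply hF hd hlb (Nat.dvd_mul_left b l) hr hn0
    (by omega) hc x rfl
  set ε := epsTop F p b n hn0 with hε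
  -- `l ∣ d` and `p ∤ d` force `l ≠ p`.
  have hln : ¬ l ∣ b * p ^ n := by
    intro h'
    rcases (Nat.Prime.dvd_mul Fact.out).1 h' with h' | h'
    · exact h h'
    · have := (Nat.prime_dvd_prime_iff_eq Fact.out Fact.out).1 (Nat.Prime.dvd_of_dvd_pow Fact.out h')
      exact hd (this ▸ (Nat.dvd_mul_right l b).trans hlb)
  have hvε : v * galUnit p τ⁻¹ ε = ε := by
    apply pUnits_ext
    let z : cyc (b * p ^ n) := ⟨1 - zeta (b * p ^ n), sub_mem (one_mem _) (zeta_mem_cyc _)⟩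
    let z' : cyc (b * p ^ n) := ⟨τ⁻¹ z, map_mem τ⁻¹ z.2⟩
    have h1 := fieldNorm_map (inf_le_right : layer F p n ⊓ cyc (b * p ^ n) ≤ cyc (b * p ^ n))
      τ⁻¹ z z' rfl
    have h2 : fieldNorm hc x * z' = z := by
      apply Subtype.ext
      have h3 : (z' : Qbar) = 1 - τ⁻¹ (zeta (b * p ^ n)) := by
        change τ⁻¹ (1 - zeta (b * p ^ n)) = _
        rw [map_sub, map_one]
      push_cast
      rw [h3]
      exact fieldNorm_one_sub_zeta_of_not_dvd (mul_assoc _ _ _) Fact.out hln hc x rfl τ (hτ n)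
    have h4 := congrArg Subtype.val (congrArg (fieldNorm
      (inf_le_right : layer F p n ⊓ cyc (b * p ^ n) ≤ cyc (b * p ^ n))) h2)
    rw [map_mul] at h4
    push_cast at h4
    rw [h1, ← hv, ← coe_epsTop b hn0 z rfl] at h4
    simpa [galUnit] using h4
  have hτζ : τ (zeta (p ^ n)) = zeta (p ^ n) ^ l := map_zeta_of_dvd (Nat.dvd_mul_left _ b) (hτ n)
  have hττ : galUnit p τ (galUnit p τ⁻¹ ε) = ε :=
    pUnits_ext (τ.apply_symm_apply _)
  have h5 := conj_alphaHom hr hτζ (r := r) (galUnit p τ⁻¹ ε)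
  rw [hττ] at h5
  -- Equivariance is applied to `τ⁻¹ ε` and then inverted, so the exponent is that of `τ`, namely
  -- `l`, and no inverse of `l` modulo `p^n` is needed.
  have h6 : alphaHom F p r n (Additive.ofMul (galUnit p τ⁻¹ ε)) =
      l ^ (r - 1) • ContH1.conj (twist F p r n) (galOver F p F) (res F p τ)⁻¹
        (alphaHom F p r n (Additive.ofMul ε)) := by
    rw [← map_nsmul, ← h5]
    rw [← ContH1.conj_mul_apply, inv_mul_cancel, map_one]
    rfl
  change _ = special F p a r b n - l ^ (r - 1) • act F p r (res F p τ)⁻¹ (special F p a r b) n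
  rw [hv', act_apply, special_apply, eps_of_le hn0 (by omega), ← h6, eq_sub_iff_add_eq, ← map_add,
    ← ofMul_mul, hvε]

end CycloElt

/-! ### The proposition -/

theorem proposition2p3
    (p : ℕ) [Fact p.Prime] (hp : p ≠ 2)
    (F : IntermediateField ℚ CycloElt.Qbar) [FiniteDimensional ℚ F] [IsAbelianGalois ℚ F]
    [NumberField.IsTotallyReal F]
    (a d : ℕ) (hcond : CycloElt.conductor F = p ^ a * d) (hd : ¬ p ∣ d)
    (r : ℕ) (hr : 1 < r) (hr' : Odd r)
    (l b : ℕ) [Fact l.Prime] [NeZero b] (hlb : l * b ∣ d) :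
    -- the special elements belong to `H¹(G_S, ℤ_p(r))`
    CycloElt.special F p a r (l * b) ∈ CycloElt.H1Zp F p r ∧
    CycloElt.special F p a r b ∈ CycloElt.H1Zp F p r ∧
    -- they are fixed by the automorphisms over `ℚ(ζ_{lbp^∞}) ∩ F`, resp. `ℚ(ζ_{bp^∞}) ∩ F`
    (∀ σ ∈ CycloElt.galOver F p (CycloElt.cycInf p (l * b) ⊓ F),
      CycloElt.act F p r σ (CycloElt.special F p a r (l * b)) =
        CycloElt.special F p a r (l * b)) ∧
    (∀ σ ∈ CycloElt.galOver F p (CycloElt.cycInf p b ⊓ F),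
      CycloElt.act F p r σ (CycloElt.special F p a r b) = CycloElt.special F p a r b) ∧
    -- the norm relations
    (¬ l ∣ b →
      (∃ σ, CycloElt.IsFrobenius F p l b σ) ∧
      ∀ σ, CycloElt.IsFrobenius F p l b σ →
        CycloElt.galNorm F p r (CycloElt.cycInf p (l * b) ⊓ F) (CycloElt.cycInf p b ⊓ F)
            (CycloElt.special F p a r (l * b)) =
          CycloElt.special F p a r b -
            l ^ (r - 1) • CycloElt.act F p r σ⁻¹ (CycloElt.special F p a r b)) ∧
    (l ∣ b →
      CycloElt.galNorm F p r (CycloElt.cycInf p (l * b) ⊓ F) (CycloElt.cycInf p b ⊓ F)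
          (CycloElt.special F p a r (l * b)) =
        CycloElt.special F p a r b) := by
  have : NeZero d := ⟨by rintro rfl; exact hd (dvd_zero p)⟩
  have hF : F ≤ CycloElt.cyc (d * p ^ a) :=
    (CycloElt.le_cyc_of_conductor_eq hcond).trans
      (CycloElt.cyc_le_of_dvd (mul_comm (p ^ a) d).dvd)
  have hb : b ∣ d := (Nat.dvd_mul_left b l).trans hlb
  have hr0 : r ≠ 0 := by omega
  refine ⟨CycloElt.special_mem_H1Zp hF hd hlb r, CycloElt.special_mem_H1Zp hF hd hb r,
    fun σ hσ => CycloElt.act_special hF hd hlb hr0 hσ,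
    fun σ hσ => CycloElt.act_special hF hd hb hr0 hσ, fun h => ⟨?_, fun σ hσ =>
      CycloElt.galNorm_special_of_not_dvd hF hd hlb hr0 h hσ⟩,
    fun h => CycloElt.galNorm_special_of_dvd hF hd hlb hr0 h⟩
  have hl : l.Prime := Fact.out
  obtain ⟨τ, hτ⟩ := CycloElt.exists_frobenius p b l ((Nat.Prime.coprime_iff_not_dvd hl).2 h)
    ((Nat.coprime_primes hl Fact.out).2 fun h' => hd (h' ▸ (Nat.dvd_mul_right l b).trans hlb))
  exact ⟨CycloElt.res F p τ, τ, hτ, fun x _ => CycloElt.res_apply τ x⟩
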